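/- **Theorem (oracle inequality for SSE-split tensor trees with mean leaves).** Let $n\ge 2$ and $d_1,d_2,K\ge 1$. Let $X_1,\dots,X_n$ be random tensors in $\mathbb{R}^{d_1\times d_2}$ with common law $P$, let $g^*:\mathbb{R}^{d_1\times d_2}\to\mathbb{R}$ be measurable with $\|g^*\|_\infty<\infty$, and let $$y_i=g^*(X_i)+\varepsilon_i,\qquad i=1,\dots,n,$$ where the pairs $(X_i,\varepsilon_i)$ are independent, $\mathbb{E}[\varepsilon_i\mid X_i]=0$, and the noise is sub-Gaussian: for some $\sigma^2>0$, $\mathbb{P}(|\varepsilon_i|\ge u)\le 2\exp(-u^2/(2\sigma^2))$ for all $u\ge0$ and all $i$. The function $g^*$ need not be additive. *The tree.* For a node containing the observations $I\subseteq\{1,\dots,n\}$ and a triplet $(j_0,j_1,j_2)\in\{1,\dots,n\}\times\{1,\dots,d_1\}\times\{1,\dots,d_2\}$, let $I_1=\{i\in I: X_i[j_1,j_2]\le X_{j_0}[j_1,j_2]\}$ and $I_2=I\setminus I_1$; the triplet is a split of the node if $I_1,I_2\ne\emptyset$, and its criterion is $$\mathrm{SSE}(j_0,j_1,j_2)=\sum_{j=1}^{2}\sum_{i\in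 I_j}\bigl(y_i-\bar y_{I_j}\bigr)^2,\qquad \bar y_{I_j}=\frac1{|I_j|}\sum_{i\in I_j}y_i .$$ Starting from the root $\{1,\dots,n\}$, every node of depth less than $K$ that has a split is divided by a split minimizing SSE (ties broken arbitrarily), which divides its region into $\{x[j_1,j_2]\le X_{j_0}[j_1,j_2]\}$ and $\{x[j_1,j_2]> X_{j_0}[j_1,j_2]\}$; the other nodes are leaves. Let $g_K$ be the function that equals, on the region of each leaf, the sample mean of the responses in that leaf. *Norms.* Let $\|f\|^2=\int f^2\,dP$, $$\mathcal{G}^1=\Bigl\{g:\ g(x)=\sum_{i_2=1}^{d_2}\sum_{i_1=1}^{d_1}g_{i_1,i_2}(x[i_1,i_2])\Bigr\},$$ and let $\|g\|_{\mathrm{TV}}$ be the infimum, over all such representations of $g$, of the sum of the total variations over $\mathbb{R}$ of the $g_{i_1,i_2}$ (possibly $+\infty$). *Conclusion.* Then $$\mathbb{E}\bigl(\|g^*-g_K\|^2\bigr)\le 2\inf_{g\in\mathcal{G}^1}\left\{\|g^*-g\|^2+\frac{\|g\|_{\mathrm{TV}}^2}{K+3}+C_1\cdot\frac{2^K\log^2(n)\log(nd_1d_2)}{n}\right\},$$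 where $C_1$ is a positive constant depending only on $\|g^*\|_\infty$ and $\sigma^2$. -/

import Mathlib

open MeasureTheory ProbabilityTheory
open scoped ENNReal

/-- A real `d₁ × d₂` input tensor. -/
abbrev Tensor (d₁ d₂ : ℕ) : Type := Fin d₁ → Fin d₂ → ℝ

/-- A binary regression tree on `ℝ^{d₁ × d₂}` with constant leaf models. An interior node
`node j₁ j₂ s l r` sends `x` to the left child `l` if `x[j₁, j₂] ≤ s` and to the right child `r` if
`x[j₁, j₂] > s`. -/
inductive TensorTree (d₁ d₂ : ℕ) : Type
  | leaf (c : ℝ) : TensorTree d₁ d₂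
  | node (j₁ : Fin d₁) (j₂ : Fin d₂) (s : ℝ) (l r : TensorTree d₁ d₂) : TensorTree d₁ d₂

/-- The (piecewise constant) regression function of a tree. -/
noncomputable def TensorTree.eval {d₁ d₂ : ℕ} : TensorTree d₁ d₂ → Tensor d₁ d₂ → ℝ
  | .leaf c, _ => c
  | .node j₁ j₂ s l r, x => if x j₁ j₂ ≤ s then l.eval x else r.eval x

section Fitting

variable {n d₁ d₂ : ℕ}

/-- Sample mean of the responses with index in `I`. -/
noncomputable def sampleMean (y : Fin n → ℝ) (I : Finset (Fin n)) : ℝ :=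
  (∑ i ∈ I, y i) / (I.card : ℝ)

/-- Sum of squared residuals of the responses with index in `I` around their sample mean. -/
noncomputable def residualSS (y : Fin n → ℝ) (I : Finset (Fin n)) : ℝ :=
  ∑ i ∈ I, (y i - sampleMean y I) ^ 2

/-- Observations of the node `I` that go to the left child. -/
noncomputable def leftChild (X : Fin n → Tensor d₁ d₂) (I : Finset (Fin n))
    (j₁ : Fin d₁) (j₂ : Fin d₂) (s : ℝ) : Finset (Fin n) :=
  I.filter fun i => X i j₁ j₂ ≤ s

/-- Observations of the node `I` that go to the right child. -/
noncomputable def rightChild (X : Fin n → Tensor d₁ d₂) (I : Finset (Fin n))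
    (j₁ : Fin d₁) (j₂ : Fin d₂) (s : ℝ) : Finset (Fin n) :=
  I.filter fun i => s < X i j₁ j₂

/-- The SSE splitting criterion: the total sum of squared residuals of the two children. -/
noncomputable def splitSSE (X : Fin n → Tensor d₁ d₂) (y : Fin n → ℝ) (I : Finset (Fin n))
    (j₁ : Fin d₁) (j₂ : Fin d₂) (s : ℝ) : ℝ :=
  residualSS y (leftChild X I j₁ j₂ s) + residualSS y (rightChild X I j₁ j₂ s)

/-- The triplet `(j₀, j₁, j₂)`, i.e. the split of entry `(j₁, j₂)` at the observed value
`X[j₀, j₁, j₂]`, really divides the node `I`: both children contain observations. -/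
def IsSplit (X : Fin n → Tensor d₁ d₂) (I : Finset (Fin n))
    (j₀ : Fin n) (j₁ : Fin d₁) (j₂ : Fin d₂) : Prop :=
  (leftChild X I j₁ j₂ (X j₀ j₁ j₂)).Nonempty ∧ (rightChild X I j₁ j₂ (X j₀ j₁ j₂)).Nonempty

/-- `IsSSETree X y K I t`: `t` is a tree grown greedily to maximal depth `K` on the observations
in `I`. At every node with remaining depth, a split `(j₀, j₁, j₂)` minimizing the SSE criterion over
all splits of the node is made, with ties broken arbitrarily. A node becomes a leaf only when the
maximal depth is reached or when it cannot be split, and then predicts the sample mean of its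
responses. -/
def IsSSETree (X : Fin n → Tensor d₁ d₂) (y : Fin n → ℝ) :
    ℕ → Finset (Fin n) → TensorTree d₁ d₂ → Prop
  | K, I, .leaf c => (K = 0 ∨ ∀ j₀ j₁ j₂, ¬ IsSplit X I j₀ j₁ j₂) ∧ c = sampleMean y I
  | 0, _, .node _ _ _ _ _ => False
  | K + 1, I, .node j₁ j₂ s l r =>
      (∃ j₀, s = X j₀ j₁ j₂ ∧ IsSplit X I j₀ j₁ j₂) ∧
      (∀ k₀ k₁ k₂, IsSplit X I k₀ k₁ k₂ →
        splitSSE X y I j₁ j₂ s ≤ splitSSE X y I k₁ k₂ (X k₀ k₁ k₂)) ∧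
      IsSSETree X y K (leftChild X I j₁ j₂ s) l ∧
      IsSSETree X y K (rightChild X I j₁ j₂ s) r

end Fitting

/-- `g(x) = ∑_{i₁, i₂} h_{i₁, i₂}(x[i₁, i₂])` for all `x`. -/
def IsAdditiveRep {d₁ d₂ : ℕ} (g : Tensor d₁ d₂ → ℝ) (h : Fin d₁ → Fin d₂ → ℝ → ℝ) : Prop :=
  ∀ x, g x = ∑ i₂, ∑ i₁, h i₁ i₂ (x i₁ i₂)

/-- The additive class `𝒢¹` of functions on `ℝ^{d₁ × d₂}`. -/
def additiveClass (d₁ d₂ : ℕ) : Set (Tensor d₁ d₂ → ℝ) :=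
  {g | ∃ h, IsAdditiveRep g h}

/-- `‖g‖_TV`: the infimum, over all additive representations of `g`, of the sum of the total
variations over `ℝ` of the component functions (possibly `∞`). -/
noncomputable def tvNorm {d₁ d₂ : ℕ} (g : Tensor d₁ d₂ → ℝ) : ℝ≥0∞ :=
  ⨅ (h : Fin d₁ → Fin d₂ → ℝ → ℝ) (_ : IsAdditiveRep g h),
    ∑ i₂, ∑ i₁, eVariationOn (h i₁ i₂) Set.univ

/-- The squared `L²(P)` distance `‖f - g‖²` (possibly `∞`). -/
noncomputable def sqL2Dist {d₁ d₂ : ℕ} (P : Measure (Tensor d₁ d₂)) (f g : Tensor d₁ d₂ → ℝ) :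
    ℝ≥0∞ :=
  ∫⁻ x, ENNReal.ofReal ((f x - g x) ^ 2) ∂P

/-! The proof compares the greedy tree with an additive `g` on the sample, deterministically, and
then transfers the comparison from the sample to `P`.

Training error. Call excess of a node its residual sum of squares minus that of `g`. The residuals
around the node mean sum to zero, and by `four_mul_sq_le_gain` their partial sums along any entry
are controlled by the best SSE gain `Δ`. Abel summation against the components of `g`, whose
variations add up to `V`, bounds the excess by `√(Δ |I|) V` (`residualSS_sub_le_of_gain_le`). A
large excess therefore forces a large gain. `excess_split_le` writes this as a family of linear
inequalities, which can be summed over the nodes of a level; iterating them down the tree gives an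
average excess of at most `V² / (K + 3)` (`IsSSETree.training_error_le`).

Generalization. The class of trees depends on the data through its thresholds, but a tree with leaf
values rounded to a grid is one of finitely many codes, each using fewer than `2 ^ K` observations
as thresholds. With those observations frozen the others remain independent, so a Bernstein estimate
for the truncated excess loss, whose variance is at most proportional to its mean up to truncation
bias, bounds the exponential moment of each code's gap (`lintegral_exp_gap_le`). Summing over codes
costs the logarithm of their number. The variance condition gives rate `1 / n`, at the price of the
factor 2 in the conclusion.

Noise is truncated at `B = b log n`, the source of the `log² n`; samples with larger noise are paid
for by the expectation of `tailSq`, which is of order `n⁻⁴`. -/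

/-! ### Abel summation and total variation -/

/-- Abel summation against a function of bounded variation on a finite set. -/
theorem abs_sum_mul_sub_le_eVariationOn {f : ℝ → ℝ} (hf : eVariationOn f Set.univ ≠ ⊤) {c : ℝ}
    (hc : 0 ≤ c) (ρ : ℝ → ℝ) (V : Finset ℝ) :
    (∀ s ∈ V, |∑ v ∈ V with v ≤ s, ρ v| ≤ c) → ∀ b, (∀ v ∈ V, v < b) →
      |∑ v ∈ V, ρ v * (f v - f b)| ≤ c * (eVariationOn f (insert b (V : Set ℝ))).toReal := by
  have hfin : ∀ s : Set ℝ, eVariationOn f s ≠ ⊤ := fun s =>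
    ne_top_of_le_ne_top hf (eVariationOn.mono f (Set.subset_univ s))
  induction V using Finset.induction_on_max with
  | empty => intro _ b _; simp only [Finset.sum_empty, abs_zero]; positivity
  | insert a V ha ih =>
    intro hs b hb
    have haV : a ∉ V := fun h => lt_irrefl _ (ha a h)
    have hab : a < b := hb a (Finset.mem_insert_self a V)
    have h1 := ih (fun s hsV => by
      have := hs s (Finset.mem_insert_of_mem hsV)
      rwa [Finset.filter_insert, if_neg (not_le.2 (ha s hsV))] at this) a ha
    have h2 : |∑ v ∈ insert a V, ρ v| ≤ c := by
      have := hs a (Finset.mem_insert_self a V)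
      rwa [Finset.filter_true_of_mem] at this
      intro v hv
      rcases Finset.mem_insert.1 hv with rfl | hv
      · exact le_rfl
      · exact (ha v hv).le
    -- Moving the reference point from `b` down to the new maximum `a` leaves one jump, weighted by
    -- a partial sum; this jump is paid for by the variation of `f` between `a` and `b`.
    have e : ∑ v ∈ insert a V, ρ v * (f v - f b) =
        ∑ v ∈ V, ρ v * (f v - f a) + (∑ v ∈ insert a V, ρ v) * (f a - f b) := by
      rw [Finset.sum_insert haV, Finset.sum_insert haV, add_mul, Finset.sum_mul]
      rw [show ∀ p q r s : ℝ, p + q = r + (p + s) ↔ q = r + s from fun p q r s => by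
        constructor <;> intro h <;> linarith]
      rw [← Finset.sum_add_distrib]
      exact Finset.sum_congr rfl fun v _ => by ring
    have h3 : (eVariationOn f (insert a (V : Set ℝ))).toReal + |f a - f b| ≤
        (eVariationOn f (insert b ((insert a V : Finset ℝ) : Set ℝ))).toReal := by
      have h4 : eVariationOn f (insert a (V : Set ℝ)) + edist (f a) (f b) ≤
          eVariationOn f (insert b ((insert a V : Finset ℝ) : Set ℝ)) := by
        calc _ ≤ eVariationOn f (insert a (V : Set ℝ)) + eVariationOn f {a, b} :=
              add_le_add le_rfl (eVariationOn.edist_le f (by simp) (by simp))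
          _ ≤ eVariationOn f (insert a (V : Set ℝ) ∪ {a, b}) := by
              apply eVariationOn.add_le_union
              intro x hx y hy
              have hxa : x ≤ a := by
                rcases hx with rfl | hx
                · exact le_rfl
                · exact (ha x hx).le
              rcases hy with rfl | rfl
              · exact hxa
              · exact hxa.trans hab.le
          _ ≤ _ := by
              apply eVariationOn.mono
              intro x hx
              simp only [Set.mem_union, Set.mem_insert_iff, Set.mem_singleton_iff,
                Finset.coe_insert, Finset.mem_coe] at hx ⊢
              tauto
      have h5 := ENNReal.toReal_mono (hfin _) h4
      rwa [ENNReal.toReal_add (hfin _) (edist_ne_top _ _), edist_dist, Real.dist_eq,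
        ENNReal.toReal_ofReal (abs_nonneg _)] at h5
    calc |∑ v ∈ insert a V, ρ v * (f v - f b)|
        ≤ |∑ v ∈ V, ρ v * (f v - f a)| + |∑ v ∈ insert a V, ρ v| * |f a - f b| := by
          rw [e, ← abs_mul]; exact abs_add_le _ _
      _ ≤ c * (eVariationOn f (insert a (V : Set ℝ))).toReal + c * |f a - f b| := by gcongr
      _ ≤ _ := by rw [← mul_add]; gcongr

/-- Grouping indices with equal `u` reduces this to the lemma above. Since `r` sums to zero,
subtracting the constant `f b` is free, with `b` any point beyond all the `u i`. -/
theorem abs_sum_mul_le_eVariationOn {ι : Type*} {f : ℝ → ℝ} (hf : eVariationOn f Set.univ ≠ ⊤)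
    {c : ℝ} (hc : 0 ≤ c) (I : Finset ι) (r u : ι → ℝ) (hr : ∑ i ∈ I, r i = 0)
    (hs : ∀ k ∈ I, |∑ i ∈ I with u i ≤ u k, r i| ≤ c) :
    |∑ i ∈ I, r i * f (u i)| ≤ c * (eVariationOn f Set.univ).toReal := by
  classical
  obtain ⟨b, hb⟩ : ∃ b, ∀ v ∈ I.image u, v < b := by
    obtain ⟨b, hb⟩ := (I.image u).bddAbove
    exact ⟨b + 1, fun v hv => (hb hv).trans_lt (lt_add_one b)⟩
  set ρ : ℝ → ℝ := fun v => ∑ i ∈ I with u i = v, r i with hρ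
  have key := abs_sum_mul_sub_le_eVariationOn hf hc ρ (I.image u) (by
    intro s hsI
    obtain ⟨k, hk, rfl⟩ := Finset.mem_image.1 hsI
    convert hs k hk using 2
    rw [← Finset.sum_fiberwise_of_maps_to (s := I.filter fun i => u i ≤ u k)
      (t := (I.image u).filter fun v => v ≤ u k) (g := u) (by
        intro i hi
        simp only [Finset.mem_filter, Finset.mem_image] at hi ⊢
        exact ⟨⟨i, hi.1, rfl⟩, hi.2⟩)]
    refine Finset.sum_congr rfl fun v hv => ?_
    rw [hρ, Finset.filter_filter]
    refine Finset.sum_congr ?_ fun _ _ => rfl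
    ext i
    simp only [Finset.mem_filter] at hv ⊢
    constructor
    · rintro ⟨h1, rfl⟩; exact ⟨h1, hv.2, rfl⟩
    · rintro ⟨h1, -, h2⟩; exact ⟨h1, h2⟩) b hb
  have e : ∑ v ∈ I.image u, ρ v * (f v - f b) = ∑ i ∈ I, r i * f (u i) := by
    have : ∑ i ∈ I, r i * f (u i) = ∑ i ∈ I, r i * (f (u i) - f b) := by
      simp only [mul_sub, Finset.sum_sub_distrib, ← Finset.sum_mul, hr, zero_mul, sub_zero]
    rw [this, ← Finset.sum_fiberwise_of_maps_to (s := I) (t := I.image u) (g := u)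
      (fun i hi => Finset.mem_image_of_mem u hi)]
    refine Finset.sum_congr rfl fun v _ => ?_
    rw [hρ, Finset.sum_mul]
    refine Finset.sum_congr rfl fun i hi => ?_
    rw [(Finset.mem_filter.1 hi).2]
  rw [← e]
  refine key.trans (mul_le_mul_of_nonneg_left ?_ hc)
  exact ENNReal.toReal_mono hf (eVariationOn.mono f (Set.subset_univ _))

/-! ### Training error of the greedy tree -/

section Fitting

variable {n d₁ d₂ : ℕ}

theorem sum_sub_sampleMean (y : Fin n → ℝ) (I : Finset (Fin n)) :
    ∑ i ∈ I, (y i - sampleMean y I) = 0 := by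
  rcases I.eq_empty_or_nonempty with rfl | hI
  · simp
  have hN : (I.card : ℝ) ≠ 0 := by exact_mod_cast hI.card_pos.ne'
  rw [Finset.sum_sub_distrib, Finset.sum_const, nsmul_eq_mul, sampleMean]
  field_simp
  ring

theorem residualSS_eq_sub (y : Fin n → ℝ) (I : Finset (Fin n)) (c : ℝ) :
    residualSS y I = ∑ i ∈ I, (y i - c) ^ 2 - (∑ i ∈ I, (y i - c)) ^ 2 / I.card := by
  rcases I.eq_empty_or_nonempty with rfl | hI
  · simp [residualSS]
  have hN : (I.card : ℝ) ≠ 0 := by exact_mod_cast hI.card_pos.ne'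
  have h1 : ∑ i ∈ I, (y i - c) = I.card * (sampleMean y I - c) := by
    rw [Finset.sum_sub_distrib, Finset.sum_const, nsmul_eq_mul, sampleMean]
    field_simp
  have h2 : ∑ i ∈ I, (y i - c) ^ 2 = residualSS y I +
      2 * (sampleMean y I - c) * (∑ i ∈ I, (y i - sampleMean y I)) +
        I.card * (sampleMean y I - c) ^ 2 := by
    rw [residualSS, Finset.mul_sum, ← Finset.sum_add_distrib, ← nsmul_eq_mul, ← Finset.sum_const,
      ← Finset.sum_add_distrib]
    exact Finset.sum_congr rfl fun i _ => by ring
  rw [h2, sum_sub_sampleMean, h1]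
  field_simp
  ring

theorem sum_leftChild_add_sum_rightChild (X : Fin n → Tensor d₁ d₂) (I : Finset (Fin n))
    (j₁ : Fin d₁) (j₂ : Fin d₂) (s : ℝ) (f : Fin n → ℝ) :
    ∑ i ∈ leftChild X I j₁ j₂ s, f i + ∑ i ∈ rightChild X I j₁ j₂ s, f i = ∑ i ∈ I, f i := by
  classical
  have : rightChild X I j₁ j₂ s = I.filter fun i => ¬ X i j₁ j₂ ≤ s := by
    simp only [rightChild, not_le]
  rw [this, leftChild, Finset.sum_filter_add_sum_filter_not]

/-- With child sizes `a`, `b` and left residual sum `ψ`, the right residual sum is `-ψ` and the gain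
is `ψ² (a + b) / (a b)`; conclude by `4 a b ≤ (a + b)²`. -/
theorem four_mul_sq_le_gain (X : Fin n → Tensor d₁ d₂) (y : Fin n → ℝ) (I : Finset (Fin n))
    (j₁ : Fin d₁) (j₂ : Fin d₂) (s : ℝ) (hL : (leftChild X I j₁ j₂ s).Nonempty)
    (hR : (rightChild X I j₁ j₂ s).Nonempty) :
    4 * (∑ i ∈ leftChild X I j₁ j₂ s, (y i - sampleMean y I)) ^ 2 ≤
      (residualSS y I - splitSSE X y I j₁ j₂ s) * I.card := by
  have h1 := sum_leftChild_add_sum_rightChild X I j₁ j₂ s fun i => (y i - sampleMean y I)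
  have h2 := sum_leftChild_add_sum_rightChild X I j₁ j₂ s fun i => (y i - sampleMean y I) ^ 2
  have h3 := sum_leftChild_add_sum_rightChild X I j₁ j₂ s fun _ => (1 : ℝ)
  rw [sum_sub_sampleMean] at h1
  simp only [Finset.sum_const, nsmul_eq_mul, mul_one] at h3
  have hL' : (0 : ℝ) < (leftChild X I j₁ j₂ s).card := by exact_mod_cast hL.card_pos
  have hR' : (0 : ℝ) < (rightChild X I j₁ j₂ s).card := by exact_mod_cast hR.card_pos
  rw [splitSSE, residualSS_eq_sub y (leftChild X I j₁ j₂ s) (sampleMean y I),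
    residualSS_eq_sub y (rightChild X I j₁ j₂ s) (sampleMean y I)]
  rw [show residualSS y I = _ from rfl, residualSS, ← h2, ← h3]
  rw [show ∑ i ∈ rightChild X I j₁ j₂ s, (y i - sampleMean y I) =
    - ∑ i ∈ leftChild X I j₁ j₂ s, (y i - sampleMean y I) by linarith]
  generalize ∑ i ∈ leftChild X I j₁ j₂ s, (y i - sampleMean y I) = ψ
  generalize ((leftChild X I j₁ j₂ s).card : ℝ) = a at *
  generalize ((rightChild X I j₁ j₂ s).card : ℝ) = b at *
  have : 4 * ψ ^ 2 ≤ (ψ ^ 2 / a + ψ ^ 2 / b) * (a + b) := by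
    rw [show (ψ ^ 2 / a + ψ ^ 2 / b) * (a + b) = ψ ^ 2 * (a + b) ^ 2 / (a * b) by
      field_simp; ring, le_div_iff₀ (by positivity)]
    nlinarith [mul_nonneg (sq_nonneg ψ) (sq_nonneg (a - b))]
  calc _ ≤ _ := this
    _ = _ := by ring

/-- The excess is at most twice the correlation of the residuals with `g`. Every partial sum of
residuals along an entry is at most `√(Δ |I|) / 2`, so Abel summation in each component applies. -/
theorem residualSS_sub_le_of_gain_le (X : Fin n → Tensor d₁ d₂) (y : Fin n → ℝ)
    {g : Tensor d₁ d₂ → ℝ} {h : Fin d₁ → Fin d₂ → ℝ → ℝ} (hg : IsAdditiveRep g h)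
    (hh : ∀ i₁ i₂, eVariationOn (h i₁ i₂) Set.univ ≠ ⊤) (I : Finset (Fin n)) {Δ : ℝ}
    (hΔ : ∀ j₀ j₁ j₂, IsSplit X I j₀ j₁ j₂ →
      residualSS y I - splitSSE X y I j₁ j₂ (X j₀ j₁ j₂) ≤ Δ) :
    residualSS y I - ∑ i ∈ I, (y i - g (X i)) ^ 2 ≤
      √(Δ * I.card) * ∑ i₂, ∑ i₁, (eVariationOn (h i₁ i₂) Set.univ).toReal := by
  set r : Fin n → ℝ := fun i => y i - sampleMean y I with hr
  have hr0 : ∑ i ∈ I, r i = 0 := sum_sub_sampleMean y I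
  have hψ : ∀ j₁ j₂, ∀ k ∈ I, |∑ i ∈ I with X i j₁ j₂ ≤ X k j₁ j₂, r i| ≤ √(Δ * I.card) / 2 := by
    intro j₁ j₂ k hk
    change |∑ i ∈ leftChild X I j₁ j₂ (X k j₁ j₂), r i| ≤ _
    have hL : (leftChild X I j₁ j₂ (X k j₁ j₂)).Nonempty :=
      ⟨k, Finset.mem_filter.2 ⟨hk, le_rfl⟩⟩
    -- With an empty right child the partial sum is the whole residual sum, which vanishes.
    rcases (rightChild X I j₁ j₂ (X k j₁ j₂)).eq_empty_or_nonempty with hR | hR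
    · have := sum_leftChild_add_sum_rightChild X I j₁ j₂ (X k j₁ j₂) r
      rw [hR, Finset.sum_empty, hr0, add_zero] at this
      rw [this, abs_zero]
      positivity
    · have h1 := four_mul_sq_le_gain X y I j₁ j₂ (X k j₁ j₂) hL hR
      have h2 := mul_le_mul_of_nonneg_right (hΔ k j₁ j₂ ⟨hL, hR⟩) (Nat.cast_nonneg (α := ℝ) I.card)
      rw [le_div_iff₀ two_pos]
      apply Real.le_sqrt_of_sq_le
      rw [mul_pow, sq_abs]
      linarith
  have hsum : ∑ i ∈ I, r i * g (X i) ≤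
      √(Δ * I.card) / 2 * ∑ i₂, ∑ i₁, (eVariationOn (h i₁ i₂) Set.univ).toReal := by
    have e : ∑ i ∈ I, r i * g (X i) = ∑ i₂, ∑ i₁, ∑ i ∈ I, r i * h i₁ i₂ (X i i₁ i₂) := by
      simp only [hg _, Finset.mul_sum]
      rw [Finset.sum_comm]
      exact Finset.sum_congr rfl fun _ _ => Finset.sum_comm
    rw [e]
    simp only [Finset.mul_sum]
    refine Finset.sum_le_sum fun i₂ _ => Finset.sum_le_sum fun i₁ _ => ?_
    exact (le_abs_self _).trans (abs_sum_mul_le_eVariationOn (hh i₁ i₂) (by positivity) I r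
      (fun i => X i i₁ i₂) hr0 (hψ i₁ i₂))
  have e2 : residualSS y I - ∑ i ∈ I, (y i - g (X i)) ^ 2 =
      2 * ∑ i ∈ I, r i * g (X i) - 2 * sampleMean y I * ∑ i ∈ I, r i -
        ∑ i ∈ I, (g (X i) - sampleMean y I) ^ 2 := by
    rw [residualSS, Finset.mul_sum, Finset.mul_sum, ← Finset.sum_sub_distrib,
      ← Finset.sum_sub_distrib, ← Finset.sum_sub_distrib]
    exact Finset.sum_congr rfl fun i _ => by simp only [hr]; ring
  have h3 : 0 ≤ ∑ i ∈ I, (g (X i) - sampleMean y I) ^ 2 :=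
    Finset.sum_nonneg fun i _ => sq_nonneg _
  rw [e2, hr0]
  linarith

theorem sum_node_eval_sq (X : Fin n → Tensor d₁ d₂) (y : Fin n → ℝ) (I : Finset (Fin n))
    (j₁ : Fin d₁) (j₂ : Fin d₂) (s : ℝ) (l r : TensorTree d₁ d₂) :
    ∑ i ∈ I, (y i - (TensorTree.node j₁ j₂ s l r).eval (X i)) ^ 2 =
      ∑ i ∈ leftChild X I j₁ j₂ s, (y i - l.eval (X i)) ^ 2 +
        ∑ i ∈ rightChild X I j₁ j₂ s, (y i - r.eval (X i)) ^ 2 := by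
  rw [← sum_leftChild_add_sum_rightChild X I j₁ j₂ s]
  congr 1
  · refine Finset.sum_congr rfl fun i hi => ?_
    rw [TensorTree.eval, if_pos (Finset.mem_filter.1 hi).2]
  · refine Finset.sum_congr rfl fun i hi => ?_
    rw [TensorTree.eval, if_neg (not_le.2 (Finset.mem_filter.1 hi).2)]

section Greedy

variable (X : Fin n → Tensor d₁ d₂) (y : Fin n → ℝ) {g : Tensor d₁ d₂ → ℝ}
  {h : Fin d₁ → Fin d₂ → ℝ → ℝ}

theorem excess_nonpos_of_not_isSplit (hg : IsAdditiveRep g h)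
    (hh : ∀ i₁ i₂, eVariationOn (h i₁ i₂) Set.univ ≠ ⊤) (I : Finset (Fin n))
    (hI : ∀ j₀ j₁ j₂, ¬ IsSplit X I j₀ j₁ j₂) :
    residualSS y I ≤ ∑ i ∈ I, (y i - g (X i)) ^ 2 := by
  have := residualSS_sub_le_of_gain_le X y hg hh I (Δ := 0)
    fun j₀ j₁ j₂ hs => absurd hs (hI j₀ j₁ j₂)
  simp only [zero_mul, Real.sqrt_zero] at this
  linarith

/-- The quadratic recursion behind greedy convergence, linearized: `2 p √(Δ |I|) V ≤ Δ + p² |I| V²`.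
Being linear in the excess, it can be added over sibling nodes with a common `p`, without any
assumption on how the excess is distributed. -/
theorem excess_split_le (hg : IsAdditiveRep g h)
    (hh : ∀ i₁ i₂, eVariationOn (h i₁ i₂) Set.univ ≠ ⊤) (I : Finset (Fin n))
    {V : ℝ} (hV : V = ∑ i₂, ∑ i₁, (eVariationOn (h i₁ i₂) Set.univ).toReal)
    {j₀ : Fin n} {j₁ : Fin d₁} {j₂ : Fin d₂} (hs : IsSplit X I j₀ j₁ j₂)
    (hmin : ∀ k₀ k₁ k₂, IsSplit X I k₀ k₁ k₂ →
        splitSSE X y I j₁ j₂ (X j₀ j₁ j₂) ≤ splitSSE X y I k₁ k₂ (X k₀ k₁ k₂))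
    {p : ℝ} (hp : 0 ≤ p) :
    splitSSE X y I j₁ j₂ (X j₀ j₁ j₂) - ∑ i ∈ I, (y i - g (X i)) ^ 2 ≤
      (1 - 2 * p) * (residualSS y I - ∑ i ∈ I, (y i - g (X i)) ^ 2) + p ^ 2 * (I.card * V ^ 2) := by
  set Δ := residualSS y I - splitSSE X y I j₁ j₂ (X j₀ j₁ j₂) with hΔ
  have h1 := residualSS_sub_le_of_gain_le X y hg hh I (Δ := Δ)
    fun k₀ k₁ k₂ hk => by have := hmin k₀ k₁ k₂ hk; linarith
  rw [← hV] at h1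
  have hI : (0 : ℝ) < I.card := by
    obtain ⟨i, hi⟩ := hs.1
    exact_mod_cast Finset.card_pos.2 ⟨i, (Finset.mem_filter.1 hi).1⟩
  have hΔ0 : 0 ≤ Δ := by
    have := four_mul_sq_le_gain X y I j₁ j₂ (X j₀ j₁ j₂) hs.1 hs.2
    have h4 : 0 ≤ Δ * I.card := le_trans (by positivity) this
    exact nonneg_of_mul_nonneg_left h4 hI
  rw [Real.sqrt_mul hΔ0] at h1
  have h2 := mul_le_mul_of_nonneg_left h1 hp
  have h3 := Real.sq_sqrt hΔ0
  have h4 := Real.sq_sqrt hI.le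
  have h5 : 2 * (p * (√Δ * √(I.card : ℝ) * V)) ≤ Δ + p ^ 2 * (I.card * V ^ 2) := by
    have : Δ + p ^ 2 * (I.card * V ^ 2) = √Δ ^ 2 + (p * (√(I.card : ℝ) * V)) ^ 2 := by
      rw [mul_pow, mul_pow, h3, h4]
    rw [this]
    nlinarith [sq_nonneg (√Δ - p * (√(I.card : ℝ) * V))]
  linarith

/-- The free parameter `z` fixes one step size `p` per level. It stays universally quantified in the
induction because the children are used with `z / (1 + z)`, which satisfies `1 + K z / (1 + z) = (1
+ (K + 1) z) / (1 + z)`. -/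
theorem IsSSETree.excess_le (hg : IsAdditiveRep g h)
    (hh : ∀ i₁ i₂, eVariationOn (h i₁ i₂) Set.univ ≠ ⊤)
    {V : ℝ} (hV : V = ∑ i₂, ∑ i₁, (eVariationOn (h i₁ i₂) Set.univ).toReal) (K : ℕ) :
    ∀ (I : Finset (Fin n)) (t : TensorTree d₁ d₂), IsSSETree X y K I t → ∀ z : ℝ, 0 ≤ z →
      ∑ i ∈ I, (y i - t.eval (X i)) ^ 2 - ∑ i ∈ I, (y i - g (X i)) ^ 2 ≤
        (1 / (1 + K * z)) ^ 2 * (residualSS y I - ∑ i ∈ I, (y i - g (X i)) ^ 2) +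
          K * (z / (1 + K * z)) ^ 2 * (I.card * V ^ 2) := by
  induction K with
  | zero =>
    rintro I (c | ⟨j₁, j₂, s, l, r⟩) ht z hz
    · rw [IsSSETree] at ht
      simp [ht.2, TensorTree.eval, residualSS]
    · rw [IsSSETree] at ht
      exact ht.elim
  | succ K ih =>
    rintro I (c | ⟨j₁, j₂, s, l, r⟩) ht z hz
    · rw [IsSSETree] at ht
      -- A node that stops early has nonpositive excess, so a factor at most 1 in front of it only
      -- weakens the bound.
      have h1 := excess_nonpos_of_not_isSplit X y hg hh I (ht.1.resolve_left (Nat.succ_ne_zero K))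
      have h2 : (1 / (1 + (K + 1 : ℕ) * z)) ^ 2 ≤ 1 := by
        apply pow_le_one₀ (by positivity)
        rw [div_le_one (by positivity)]
        nlinarith [mul_nonneg (Nat.cast_nonneg (α := ℝ) (K + 1)) hz]
      have h3 : 0 ≤ ((K + 1 : ℕ) : ℝ) * (z / (1 + (K + 1 : ℕ) * z)) ^ 2 * (I.card * V ^ 2) := by
        positivity
      have h4 : ∑ i ∈ I, (y i - (TensorTree.leaf c).eval (X i)) ^ 2 = residualSS y I := by
        simp [ht.2, TensorTree.eval, residualSS]
      rw [h4]
      nlinarith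
    · rw [IsSSETree] at ht
      obtain ⟨⟨j₀, rfl, hs⟩, hmin, hl, hr⟩ := ht
      have hz' : 0 ≤ z / (1 + z) := by positivity
      have hL := ih _ l hl (z / (1 + z)) hz'
      have hR := ih _ r hr (z / (1 + z)) hz'
      -- `p` is chosen so that `1 - 2 p = 1 / (1 + z)²`, which makes the contraction factors
      -- telescope.
      have hsp := excess_split_le X y hg hh I hV hs hmin
        (p := (1 - (1 / (1 + z)) ^ 2) / 2) (by
          have : (1 / (1 + z)) ^ 2 ≤ 1 := by
            apply pow_le_one₀ (by positivity)
            rw [div_le_one (by positivity)]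
            linarith
          linarith)
      have hp2 : ((1 - (1 / (1 + z)) ^ 2) / 2) ^ 2 ≤ (z / (1 + z)) ^ 2 := by
        have : (1 - (1 / (1 + z)) ^ 2) / 2 = z / (1 + z) * ((1 + z / 2) / (1 + z)) := by
          field_simp; ring
        rw [this, mul_pow]
        refine mul_le_of_le_one_right (by positivity) (pow_le_one₀ (by positivity) ?_)
        rw [div_le_one (by positivity)]
        linarith
      have e1 := sum_leftChild_add_sum_rightChild X I j₁ j₂ (X j₀ j₁ j₂)
        fun i => (y i - g (X i)) ^ 2
      have e2 := sum_leftChild_add_sum_rightChild X I j₁ j₂ (X j₀ j₁ j₂) fun _ => (1 : ℝ)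
      simp only [Finset.sum_const, nsmul_eq_mul, mul_one] at e2
      rw [sum_node_eval_sq]
      rw [splitSSE] at hsp
      have hw : 1 + (K : ℝ) * (z / (1 + z)) = (1 + (K + 1 : ℕ) * z) / (1 + z) := by
        push_cast; field_simp; ring
      have hpos : 0 < 1 + ((K + 1 : ℕ) : ℝ) * z := by positivity
      have hz1 : 0 < 1 + z := by positivity
      rw [hw] at hL hR
      generalize ∑ i ∈ leftChild X I j₁ j₂ (X j₀ j₁ j₂), (y i - l.eval (X i)) ^ 2 = tl at *
      generalize ∑ i ∈ rightChild X I j₁ j₂ (X j₀ j₁ j₂), (y i - r.eval (X i)) ^ 2 = tr at *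
      generalize ∑ i ∈ leftChild X I j₁ j₂ (X j₀ j₁ j₂), (y i - g (X i)) ^ 2 = gl at *
      generalize ∑ i ∈ rightChild X I j₁ j₂ (X j₀ j₁ j₂), (y i - g (X i)) ^ 2 = gr at *
      generalize ∑ i ∈ I, (y i - g (X i)) ^ 2 = gI at *
      generalize residualSS y (leftChild X I j₁ j₂ (X j₀ j₁ j₂)) = sl at *
      generalize residualSS y (rightChild X I j₁ j₂ (X j₀ j₁ j₂)) = sr at *
      generalize residualSS y I = sI at *
      generalize ((leftChild X I j₁ j₂ (X j₀ j₁ j₂)).card : ℝ) = nl at *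
      generalize ((rightChild X I j₁ j₂ (X j₀ j₁ j₂)).card : ℝ) = nr at *
      have hN : 0 ≤ (I.card : ℝ) * V ^ 2 := by positivity
      generalize (I.card : ℝ) = nI at *
      have hKc : (((K + 1 : ℕ) : ℝ)) = K + 1 := by push_cast; ring
      set D := 1 + ((K + 1 : ℕ) : ℝ) * z with hD
      set w2 := (1 / (D / (1 + z))) ^ 2 with hw2
      have hw2n : 0 ≤ w2 := by positivity
      have s1 : tl + tr - gI ≤ w2 * (sl + sr - gI) +
          K * (z / (1 + z) / (D / (1 + z))) ^ 2 * (nI * V ^ 2) := by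
        rw [← e1, ← e2]
        have := add_le_add hL hR
        linarith
      have s2 : sl + sr - gI ≤ (1 / (1 + z)) ^ 2 * (sI - gI) + (z / (1 + z)) ^ 2 * (nI * V ^ 2) := by
        have := mul_le_mul_of_nonneg_right hp2 hN
        linarith
      have s3 := mul_le_mul_of_nonneg_left s2 hw2n
      have s4 : w2 * ((1 / (1 + z)) ^ 2 * (sI - gI) + (z / (1 + z)) ^ 2 * (nI * V ^ 2)) +
          K * (z / (1 + z) / (D / (1 + z))) ^ 2 * (nI * V ^ 2) =
          (1 / D) ^ 2 * (sI - gI) + ((K + 1 : ℕ) : ℝ) * (z / D) ^ 2 * (nI * V ^ 2) := by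
        rw [hw2, hKc]
        field_simp
        ring
      linarith

/-- Training error of a greedy tree of depth `K` against an additive function. -/
theorem IsSSETree.training_error_le (hg : IsAdditiveRep g h)
    (hh : ∀ i₁ i₂, eVariationOn (h i₁ i₂) Set.univ ≠ ⊤)
    {V : ℝ} (hV : V = ∑ i₂, ∑ i₁, (eVariationOn (h i₁ i₂) Set.univ).toReal) {K : ℕ} (hK : 1 ≤ K)
    (I : Finset (Fin n)) (t : TensorTree d₁ d₂) (ht : IsSSETree X y K I t) :
    ∑ i ∈ I, (y i - t.eval (X i)) ^ 2 ≤
      ∑ i ∈ I, (y i - g (X i)) ^ 2 + I.card * (V ^ 2 / (K + 3)) := by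
  obtain ⟨k, rfl⟩ : ∃ k, K = k + 1 := ⟨K - 1, by omega⟩
  rcases t with c | ⟨j₁, j₂, s, l, r⟩
  · rw [IsSSETree] at ht
    have h1 := excess_nonpos_of_not_isSplit X y hg hh I (ht.1.resolve_left (Nat.succ_ne_zero k))
    have h4 : ∑ i ∈ I, (y i - (TensorTree.leaf c).eval (X i)) ^ 2 = residualSS y I := by
      simp [ht.2, TensorTree.eval, residualSS]
    have : 0 ≤ (I.card : ℝ) * (V ^ 2 / ((k + 1 : ℕ) + 3)) := by positivity
    linarith
  · rw [IsSSETree] at ht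
    obtain ⟨⟨j₀, rfl, hs⟩, hmin, hl, hr⟩ := ht
    -- The root is split with `p = 1 / 2`, which erases its uncontrolled excess and leaves `|I| V² /
    -- 4`. With `z = 1 / 4` on the other `k = K - 1` levels the coefficients add up to `4 / (k + 4)²
    -- + k / (k + 4)² = 1 / (K + 3)`.
    have hL := IsSSETree.excess_le X y hg hh hV k _ l hl (1 / 4) (by norm_num)
    have hR := IsSSETree.excess_le X y hg hh hV k _ r hr (1 / 4) (by norm_num)
    have hsp := excess_split_le X y hg hh I hV hs hmin (p := 1 / 2) (by norm_num)
    have e1 := sum_leftChild_add_sum_rightChild X I j₁ j₂ (X j₀ j₁ j₂)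
      fun i => (y i - g (X i)) ^ 2
    have e2 := sum_leftChild_add_sum_rightChild X I j₁ j₂ (X j₀ j₁ j₂) fun _ => (1 : ℝ)
    simp only [Finset.sum_const, nsmul_eq_mul, mul_one] at e2
    rw [sum_node_eval_sq]
    rw [splitSSE] at hsp
    have hsum := add_le_add hL hR
    set w2 := (1 / (1 + (k : ℝ) * (1 / 4))) ^ 2 with hw2
    have hw2n : 0 ≤ w2 := by positivity
    have hsp' : residualSS y (leftChild X I j₁ j₂ (X j₀ j₁ j₂)) +
        residualSS y (rightChild X I j₁ j₂ (X j₀ j₁ j₂)) - ∑ i ∈ I, (y i - g (X i)) ^ 2 ≤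
        1 / 4 * (I.card * V ^ 2) := by linarith
    have s3 := mul_le_mul_of_nonneg_left hsp' hw2n
    have s4 : w2 * (1 / 4 * (I.card * V ^ 2)) +
        k * (1 / 4 / (1 + (k : ℝ) * (1 / 4))) ^ 2 * (I.card * V ^ 2) =
        I.card * (V ^ 2 / ((k + 1 : ℕ) + 3)) := by
      rw [hw2]; push_cast
      have : (k : ℝ) + 4 ≠ 0 := by positivity
      have h2 : (k : ℝ) + 1 + 3 ≠ 0 := by positivity
      field_simp
      ring
    rw [← e1, ← s4, ← e2]
    rw [← e1, ← e2] at s3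
    linarith

end Greedy

end Fitting

/-! ### Finite codes for trees -/

section TreeCode

/-- Codes of complete binary trees of depth `K`: every node names a triplet `(j₀, j₁, j₂)` and every
leaf an element of `Fin m`, the index of its value. -/
def TreeCode (n d₁ d₂ m : ℕ) : ℕ → Type
  | 0 => Fin m
  | K + 1 => (Fin n × Fin d₁ × Fin d₂) × TreeCode n d₁ d₂ m K × TreeCode n d₁ d₂ m K

variable {n d₁ d₂ m : ℕ}

noncomputable instance TreeCode.instFintype : ∀ K, Fintype (TreeCode n d₁ d₂ m K)
  | 0 => inferInstanceAs (Fintype (Fin m))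
  | K + 1 =>
    letI := TreeCode.instFintype K
    inferInstanceAs (Fintype
      ((Fin n × Fin d₁ × Fin d₂) × TreeCode n d₁ d₂ m K × TreeCode n d₁ d₂ m K))

theorem TreeCode.card_le (hn : 0 < n) (h₁ : 0 < d₁) (h₂ : 0 < d₂) (K : ℕ) :
    Fintype.card (TreeCode n d₁ d₂ m K) ≤ (n * d₁ * d₂ * m) ^ 2 ^ K := by
  have hN : 1 ≤ n * d₁ * d₂ := Nat.succ_le_of_lt (by positivity)
  -- The extra factor `n * d₁ * d₂` turns the recursion for the cardinality into exact squaring.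
  have key : n * d₁ * d₂ * Fintype.card (TreeCode n d₁ d₂ m K) ≤ (n * d₁ * d₂ * m) ^ 2 ^ K := by
    induction K with
    | zero =>
      have : Fintype.card (TreeCode n d₁ d₂ m 0) = m := Fintype.card_fin m
      rw [this, pow_zero, pow_one]
    | succ K ih =>
      have : Fintype.card (TreeCode n d₁ d₂ m (K + 1)) = n * d₁ * d₂ *
          (Fintype.card (TreeCode n d₁ d₂ m K) * Fintype.card (TreeCode n d₁ d₂ m K)) := by
        have : Fintype.card (TreeCode n d₁ d₂ m (K + 1)) = Fintype.card
          ((Fin n × Fin d₁ × Fin d₂) × TreeCode n d₁ d₂ m K × TreeCode n d₁ d₂ m K) := rfl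
        rw [this, Fintype.card_prod, Fintype.card_prod, Fintype.card_prod, Fintype.card_prod,
          Fintype.card_fin, Fintype.card_fin, Fintype.card_fin]
        ring
      rw [this, pow_succ, pow_mul, sq]
      calc _ = (n * d₁ * d₂ * Fintype.card (TreeCode n d₁ d₂ m K)) *
            (n * d₁ * d₂ * Fintype.card (TreeCode n d₁ d₂ m K)) := by ring
        _ ≤ _ := Nat.mul_le_mul ih ih
  exact (Nat.le_mul_of_pos_left _ hN).trans key

/-- The regression function of a code, with thresholds from the sample `X` and leaf values `v`. -/
noncomputable def TreeCode.eval (v : Fin m → ℝ) (X : Fin n → Tensor d₁ d₂) (x : Tensor d₁ d₂) :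
    ∀ {K : ℕ}, TreeCode n d₁ d₂ m K → ℝ
  | 0, (i : Fin m) => v i
  | _ + 1, ((j₀, j₁, j₂), l, r) =>
      if x j₁ j₂ ≤ X j₀ j₁ j₂ then TreeCode.eval v X x l else TreeCode.eval v X x r

/-- The observations whose entries are used as thresholds. -/
def TreeCode.support : ∀ {K : ℕ}, TreeCode n d₁ d₂ m K → Finset (Fin n)
  | 0, _ => ∅
  | _ + 1, ((j₀, _, _), l, r) => insert j₀ (TreeCode.support l ∪ TreeCode.support r)

theorem TreeCode.card_support_le : ∀ {K : ℕ} (θ : TreeCode n d₁ d₂ m K),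
    θ.support.card + 1 ≤ 2 ^ K
  | 0, _ => by simp [TreeCode.support]
  | K + 1, ((j₀, j₁, j₂), l, r) => by
    have hl := TreeCode.card_support_le l
    have hr := TreeCode.card_support_le r
    have h1 := Finset.card_insert_le j₀ (TreeCode.support l ∪ TreeCode.support r)
    have h2 := Finset.card_union_le (TreeCode.support l) (TreeCode.support r)
    rw [TreeCode.support, pow_succ]
    omega

theorem TreeCode.eval_congr (v : Fin m → ℝ) {X X' : Fin n → Tensor d₁ d₂} (x : Tensor d₁ d₂) :
    ∀ {K : ℕ} (θ : TreeCode n d₁ d₂ m K), (∀ i ∈ θ.support, X i = X' i) →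
      θ.eval v X x = θ.eval v X' x
  | 0, _, _ => rfl
  | K + 1, ((j₀, j₁, j₂), l, r), h => by
    rw [TreeCode.support] at h
    have hl := TreeCode.eval_congr v x l fun i hi => h i (by simp [hi])
    have hr := TreeCode.eval_congr v x r fun i hi => h i (by simp [hi])
    rw [TreeCode.eval, TreeCode.eval, hl, hr, h j₀ (by simp)]

theorem TreeCode.measurable_eval (v : Fin m → ℝ) : ∀ {K : ℕ} (θ : TreeCode n d₁ d₂ m K),
    Measurable fun p : (Fin n → Tensor d₁ d₂) × Tensor d₁ d₂ => θ.eval v p.1 p.2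
  | 0, _ => measurable_const
  | K + 1, ((j₀, j₁, j₂), l, r) => by
    have hl := TreeCode.measurable_eval v l
    have hr := TreeCode.measurable_eval v r
    simp only [TreeCode.eval]
    refine Measurable.ite (measurableSet_le ?_ ?_) hl hr
    · fun_prop
    · fun_prop

theorem TreeCode.abs_eval_le (v : Fin m → ℝ) {R : ℝ} (hv : ∀ i, |v i| ≤ R)
    (X : Fin n → Tensor d₁ d₂) (x : Tensor d₁ d₂) :
    ∀ {K : ℕ} (θ : TreeCode n d₁ d₂ m K), |θ.eval v X x| ≤ R
  | 0, i => hv i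
  | K + 1, ((j₀, j₁, j₂), l, r) => by
    have hl := TreeCode.abs_eval_le v hv X x l
    have hr := TreeCode.abs_eval_le v hv X x r
    rw [TreeCode.eval]
    split_ifs <;> assumption

/-- A constant function has a code of every depth. -/
theorem TreeCode.exists_eval_eq_const (v : Fin m → ℝ) (i : Fin m) (j₀ : Fin n) (j₁ : Fin d₁)
    (j₂ : Fin d₂) (X : Fin n → Tensor d₁ d₂) (K : ℕ) :
    ∃ θ : TreeCode n d₁ d₂ m K, ∀ x, θ.eval v X x = v i := by
  induction K with
  | zero => exact ⟨(i : Fin m), fun _ => rfl⟩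
  | succ K ih =>
    obtain ⟨θ, hθ⟩ := ih
    exact ⟨((j₀, j₁, j₂), θ, θ), fun x => by rw [TreeCode.eval, hθ, ite_self]⟩

end TreeCode

/-! ### Approximation of fitted trees by codes -/

section Fitting

variable {n d₁ d₂ : ℕ}

theorem TensorTree.measurable_eval (t : TensorTree d₁ d₂) : Measurable t.eval := by
  induction t with
  | leaf c => exact measurable_const
  | node j₁ j₂ s l r hl hr =>
    have : (TensorTree.node j₁ j₂ s l r).eval =
      fun x : Tensor d₁ d₂ => if x j₁ j₂ ≤ s then l.eval x else r.eval x := by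
      ext x; rw [TensorTree.eval]
    rw [this]
    refine Measurable.ite (measurableSet_le ?_ ?_) hl hr <;> fun_prop

theorem abs_sampleMean_le {y : Fin n → ℝ} {R : ℝ} (hR : 0 ≤ R) (hy : ∀ i, |y i| ≤ R)
    (I : Finset (Fin n)) : |sampleMean y I| ≤ R := by
  rcases I.eq_empty_or_nonempty with rfl | hI
  · simpa [sampleMean] using hR
  have hN : (0 : ℝ) < I.card := by exact_mod_cast hI.card_pos
  rw [sampleMean, abs_div, Nat.abs_cast, div_le_iff₀ hN]
  calc |∑ i ∈ I, y i| ≤ ∑ i ∈ I, |y i| := Finset.abs_sum_le_sum_abs _ _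
    _ ≤ ∑ _i ∈ I, R := Finset.sum_le_sum fun i _ => hy i
    _ = R * I.card := by rw [Finset.sum_const, nsmul_eq_mul, mul_comm]

theorem IsSSETree.abs_eval_le {X : Fin n → Tensor d₁ d₂} {y : Fin n → ℝ} {R : ℝ} (hR : 0 ≤ R)
    (hy : ∀ i, |y i| ≤ R) (x : Tensor d₁ d₂) (K : ℕ) :
    ∀ (I : Finset (Fin n)) (t : TensorTree d₁ d₂), IsSSETree X y K I t → |t.eval x| ≤ R := by
  induction K with
  | zero =>
    rintro I (c | ⟨j₁, j₂, s, l, r⟩) ht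
    · rw [IsSSETree] at ht
      rw [TensorTree.eval, ht.2]
      exact abs_sampleMean_le hR hy I
    · rw [IsSSETree] at ht
      exact ht.elim
  | succ K ih =>
    rintro I (c | ⟨j₁, j₂, s, l, r⟩) ht
    · rw [IsSSETree] at ht
      rw [TensorTree.eval, ht.2]
      exact abs_sampleMean_le hR hy I
    · rw [IsSSETree] at ht
      rw [TensorTree.eval]
      split_ifs
      · exact ih _ l ht.2.2.1
      · exact ih _ r ht.2.2.2

/-- A greedily grown tree is approximated by a code whose values form a `δ`-net. -/
theorem IsSSETree.exists_code {m : ℕ} {X : Fin n → Tensor d₁ d₂} {y : Fin n → ℝ} {R δ : ℝ}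
    (hR : 0 ≤ R) (hy : ∀ i, |y i| ≤ R) (v : Fin m → ℝ)
    (hv : ∀ c : ℝ, |c| ≤ R → ∃ i, |c - v i| ≤ δ) (j₀ : Fin n) (j₁ : Fin d₁) (j₂ : Fin d₂)
    (K : ℕ) :
    ∀ (I : Finset (Fin n)) (t : TensorTree d₁ d₂), IsSSETree X y K I t →
      ∃ θ : TreeCode n d₁ d₂ m K, ∀ x, |t.eval x - θ.eval v X x| ≤ δ := by
  have leaf : ∀ K (I : Finset (Fin n)) (c : ℝ), c = sampleMean y I →
      ∃ θ : TreeCode n d₁ d₂ m K, ∀ x, |(TensorTree.leaf c).eval x - θ.eval v X x| ≤ δ := by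
    intro K I c hc
    obtain ⟨i, hi⟩ := hv c (hc ▸ abs_sampleMean_le hR hy I)
    obtain ⟨θ, hθ⟩ := TreeCode.exists_eval_eq_const v i j₀ j₁ j₂ X K
    exact ⟨θ, fun x => by rw [hθ, TensorTree.eval]; exact hi⟩
  induction K with
  | zero =>
    rintro I (c | ⟨j₁, j₂, s, l, r⟩) ht
    · rw [IsSSETree] at ht
      exact leaf 0 I c ht.2
    · rw [IsSSETree] at ht
      exact ht.elim
  | succ K ih =>
    rintro I (c | ⟨j₁, j₂, s, l, r⟩) ht
    · rw [IsSSETree] at ht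
      exact leaf (K + 1) I c ht.2
    · rw [IsSSETree] at ht
      obtain ⟨⟨k₀, rfl, -⟩, -, hl, hr⟩ := ht
      obtain ⟨θl, hθl⟩ := ih _ l hl
      obtain ⟨θr, hθr⟩ := ih _ r hr
      refine ⟨((k₀, j₁, j₂), θl, θr), fun x => ?_⟩
      rw [TensorTree.eval, TreeCode.eval]
      split_ifs
      · exact hθl x
      · exact hθr x

/-- The points `-R + 2Ri/n`, `0 ≤ i ≤ n`. -/
noncomputable def uniformGrid (n : ℕ) (R : ℝ) (i : Fin (n + 1)) : ℝ := -R + 2 * R * i / n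

theorem abs_uniformGrid_le {R : ℝ} (hn : 0 < n) (hR : 0 ≤ R) (i : Fin (n + 1)) :
    |uniformGrid n R i| ≤ R := by
  have hn' : (0 : ℝ) < n := by exact_mod_cast hn
  have hi : (i : ℝ) ≤ n := by exact_mod_cast Nat.lt_succ_iff.1 i.2
  have h1 : 2 * R * i / n ≤ 2 * R := by
    rw [div_le_iff₀ hn']
    exact mul_le_mul_of_nonneg_left hi (by positivity)
  have h2 : 0 ≤ 2 * R * i / n := by positivity
  rw [uniformGrid, abs_le]
  constructor <;> linarith

theorem exists_abs_sub_uniformGrid_le {R : ℝ} (hn : 0 < n) (hR : 0 < R) {c : ℝ} (hc : |c| ≤ R) :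
    ∃ i, |c - uniformGrid n R i| ≤ 2 * R / n := by
  have hn' : (0 : ℝ) < n := by exact_mod_cast hn
  obtain ⟨h1, h2⟩ := abs_le.1 hc
  set u := (c + R) * n / (2 * R) with hu
  have hu0 : 0 ≤ u := by
    have : 0 ≤ c + R := by linarith
    positivity
  have hun : u ≤ n := by
    rw [hu, div_le_iff₀ (by positivity), mul_comm]
    exact mul_le_mul_of_nonneg_left (by linarith) hn'.le
  refine ⟨⟨⌊u⌋₊, Nat.lt_succ_of_le (Nat.floor_le_of_le hun)⟩, ?_⟩
  have h3 := Nat.floor_le hu0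
  have h4 := Nat.lt_floor_add_one u
  have hcu : c = -R + 2 * R * u / n := by rw [hu]; field_simp; ring
  have e : c - uniformGrid n R ⟨⌊u⌋₊, Nat.lt_succ_of_le (Nat.floor_le_of_le hun)⟩ =
      2 * R / n * (u - ⌊u⌋₊) := by
    simp only [uniformGrid]
    linear_combination hcu
  rw [e, abs_mul, abs_of_nonneg (by positivity : 0 ≤ 2 * R / (n : ℝ))]
  refine mul_le_of_le_one_right (by positivity) ?_
  rw [abs_le]
  constructor <;> linarith

end Fitting

/-! ### Sub-Gaussian noise, truncation and a Bernstein bound -/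

section SubGaussian

variable {Ω : Type*} [MeasurableSpace Ω] {μ : Measure Ω} [IsProbabilityMeasure μ]

/-- Layer cake: levels `t ≤ 1` contribute at most 1. For `t > 1` the tail bound at `u² = 4 s log t`
is `2 t⁻²`, with integral 2. -/
theorem lintegral_exp_sq_le_of_tail {s : ℝ} (hs : 0 < s) {ε : Ω → ℝ} (hε : Measurable ε)
    (htail : ∀ u : ℝ, 0 ≤ u → μ.real {ω | u ≤ |ε ω|} ≤ 2 * Real.exp (-u ^ 2 / (2 * s))) :
    ∫⁻ ω, ENNReal.ofReal (Real.exp (ε ω ^ 2 / (4 * s))) ∂μ ≤ ENNReal.ofReal 3 := by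
  rw [lintegral_eq_lintegral_meas_le μ (Filter.Eventually.of_forall fun ω => (Real.exp_pos _).le)
    (by fun_prop)]
  have hsplit : Set.Ioi (0 : ℝ) = Set.Ioc 0 1 ∪ Set.Ioi 1 :=
    (Set.Ioc_union_Ioi_eq_Ioi zero_le_one).symm
  have h1 : ∫⁻ t in Set.Ioc (0 : ℝ) 1, μ {ω | t ≤ Real.exp (ε ω ^ 2 / (4 * s))} ≤ 1 := by
    calc _ ≤ ∫⁻ _t in Set.Ioc (0 : ℝ) 1, 1 := lintegral_mono fun _ => prob_le_one
      _ = 1 := by simp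
  have h2 : ∫⁻ t in Set.Ioi (1 : ℝ), μ {ω | t ≤ Real.exp (ε ω ^ 2 / (4 * s))} ≤
      ENNReal.ofReal 2 := by
    have hint := integrableOn_Ioi_rpow_of_lt (a := -2) (by norm_num) (c := 1) one_pos
    calc _ ≤ ∫⁻ t in Set.Ioi (1 : ℝ), ENNReal.ofReal (2 * t ^ (-2 : ℝ)) := by
          refine setLIntegral_mono' measurableSet_Ioi fun t ht => ?_
          have ht1 : (1 : ℝ) < t := ht
          have ht0 : 0 < t := by linarith
          have hl : 0 ≤ Real.log t := Real.log_nonneg ht1.le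
          have hset : {ω | t ≤ Real.exp (ε ω ^ 2 / (4 * s))} =
              {ω | √(4 * s * Real.log t) ≤ |ε ω|} := by
            ext ω
            simp only [Set.mem_ofPred_eq]
            rw [← Real.log_le_iff_le_exp ht0, le_div_iff₀ (by positivity),
              Real.sqrt_le_left (abs_nonneg _), sq_abs, mul_comm]
          rw [hset, ← ENNReal.ofReal_toReal (measure_ne_top μ _)]
          refine ENNReal.ofReal_le_ofReal ((htail _ (Real.sqrt_nonneg _)).trans_eq ?_)
          rw [Real.sq_sqrt (by positivity), Real.rpow_def_of_pos ht0]
          congr 2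
          field_simp
          ring
      _ = ENNReal.ofReal (∫ t in Set.Ioi (1 : ℝ), 2 * t ^ (-2 : ℝ)) := by
          rw [ofReal_integral_eq_lintegral_ofReal (hint.const_mul 2)]
          refine (ae_restrict_iff' measurableSet_Ioi).2 (Filter.Eventually.of_forall fun t ht => ?_)
          have ht0 : (0 : ℝ) < t := one_pos.trans ht
          simp only [Pi.zero_apply]
          positivity
      _ = ENNReal.ofReal 2 := by
          rw [integral_const_mul, integral_Ioi_rpow_of_lt (by norm_num) one_pos]
          norm_num
  rw [hsplit, lintegral_union measurableSet_Ioi (Set.Ioc_disjoint_Ioi le_rfl)]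
  calc _ ≤ (1 : ℝ≥0∞) + ENNReal.ofReal 2 := add_le_add h1 h2
    _ = ENNReal.ofReal 3 := by
        rw [← ENNReal.ofReal_one, ← ENNReal.ofReal_add (by norm_num) (by norm_num)]; norm_num

theorem integrable_exp_sq_of_tail {s : ℝ} (hs : 0 < s) {ε : Ω → ℝ} (hε : Measurable ε)
    (htail : ∀ u : ℝ, 0 ≤ u → μ.real {ω | u ≤ |ε ω|} ≤ 2 * Real.exp (-u ^ 2 / (2 * s))) :
    Integrable (fun ω => Real.exp (ε ω ^ 2 / (4 * s))) μ ∧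
      ∫ ω, Real.exp (ε ω ^ 2 / (4 * s)) ∂μ ≤ 3 := by
  have h := lintegral_exp_sq_le_of_tail hs hε htail
  have hi : Integrable (fun ω => Real.exp (ε ω ^ 2 / (4 * s))) μ := by
    refine ⟨by fun_prop, ?_⟩
    rw [hasFiniteIntegral_iff_ofReal (Filter.Eventually.of_forall fun ω => (Real.exp_pos _).le)]
    exact h.trans_lt ENNReal.ofReal_lt_top
  refine ⟨hi, ?_⟩
  rw [← ofReal_integral_eq_lintegral_ofReal hi
    (Filter.Eventually.of_forall fun ω => (Real.exp_pos _).le)] at h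
  exact (ENNReal.ofReal_le_ofReal_iff (by norm_num)).1 h

theorem integrable_sq_of_tail {s : ℝ} (hs : 0 < s) {ε : Ω → ℝ} (hε : Measurable ε)
    (htail : ∀ u : ℝ, 0 ≤ u → μ.real {ω | u ≤ |ε ω|} ≤ 2 * Real.exp (-u ^ 2 / (2 * s))) :
    Integrable (fun ω => ε ω ^ 2) μ := by
  refine ((integrable_exp_sq_of_tail hs hε htail).1.const_mul (4 * s)).mono' (by fun_prop)
    (Filter.Eventually.of_forall fun ω => ?_)
  rw [Real.norm_of_nonneg (sq_nonneg _)]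
  have := Real.add_one_le_exp (ε ω ^ 2 / (4 * s))
  calc ε ω ^ 2 = 4 * s * (ε ω ^ 2 / (4 * s)) := by field_simp
    _ ≤ _ := by gcongr; linarith

theorem integrable_of_tail {s : ℝ} (hs : 0 < s) {ε : Ω → ℝ} (hε : Measurable ε)
    (htail : ∀ u : ℝ, 0 ≤ u → μ.real {ω | u ≤ |ε ω|} ≤ 2 * Real.exp (-u ^ 2 / (2 * s))) :
    Integrable ε μ := by
  refine ((integrable_const (1 : ℝ)).add (integrable_sq_of_tail hs hε htail)).mono' (by fun_prop)
    (Filter.Eventually.of_forall fun ω => ?_)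
  rw [Real.norm_eq_abs, Pi.add_apply, ← sq_abs]
  nlinarith [sq_nonneg (|ε ω| - 1)]

/-- The square of the part of `e` beyond `B`. -/
noncomputable def tailSq (B e : ℝ) : ℝ := if |e| ≤ B then 0 else e ^ 2

theorem measurable_tailSq (B : ℝ) : Measurable (tailSq B) :=
  Measurable.ite (measurableSet_le (by fun_prop) (by fun_prop)) measurable_const (by fun_prop)

theorem tailSq_nonneg (B e : ℝ) : 0 ≤ tailSq B e := by
  rw [tailSq]; split_ifs <;> positivity

theorem tailSq_le (B e : ℝ) : tailSq B e ≤ e ^ 2 := by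
  rw [tailSq]; split_ifs <;> [positivity; exact le_rfl]

theorem integrable_tailSq {Ω : Type*} [MeasurableSpace Ω] {μ : Measure Ω} {B : ℝ} {ε : Ω → ℝ} (hε : Measurable ε)
    (hi : Integrable (fun ω => ε ω ^ 2) μ) : Integrable (fun ω => tailSq B (ε ω)) μ :=
  hi.mono' ((measurable_tailSq B).comp hε).aestronglyMeasurable
    (Filter.Eventually.of_forall fun ω => by
      rw [Real.norm_of_nonneg (tailSq_nonneg _ _)]; exact tailSq_le _ _)

/-- Half of the exponent in `exp (ε² / (4 s))` dominates `ε²`; on `|ε| > B` the other half gains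
`exp (-B² / (8 s))`. -/
theorem integral_tailSq_le_of_tail {s : ℝ} (hs : 0 < s) {ε : Ω → ℝ} (hε : Measurable ε)
    (htail : ∀ u : ℝ, 0 ≤ u → μ.real {ω | u ≤ |ε ω|} ≤ 2 * Real.exp (-u ^ 2 / (2 * s)))
    {B : ℝ} (hB : 0 ≤ B) :
    ∫ ω, tailSq B (ε ω) ∂μ ≤ 24 * s * Real.exp (-B ^ 2 / (8 * s)) := by
  obtain ⟨h1, h2⟩ := integrable_exp_sq_of_tail hs hε htail
  calc ∫ ω, tailSq B (ε ω) ∂μ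
      ≤ ∫ ω, 8 * s * Real.exp (-B ^ 2 / (8 * s)) * Real.exp (ε ω ^ 2 / (4 * s)) ∂μ := by
        refine integral_mono (integrable_tailSq hε (integrable_sq_of_tail hs hε htail))
          (h1.const_mul _) fun ω => ?_
        simp only [tailSq]
        split_ifs with h
        · positivity
        · have hB2 : B ^ 2 ≤ ε ω ^ 2 := by
            rw [← sq_abs (ε ω)]
            exact pow_le_pow_left₀ hB (not_le.1 h).le 2
          have h3 := Real.add_one_le_exp (ε ω ^ 2 / (8 * s))
          have h4 : Real.exp (ε ω ^ 2 / (8 * s)) ≤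
              Real.exp (-B ^ 2 / (8 * s)) * Real.exp (ε ω ^ 2 / (4 * s)) := by
            rw [← Real.exp_add]
            apply Real.exp_le_exp.2
            rw [← sub_nonneg]
            have : -B ^ 2 / (8 * s) + ε ω ^ 2 / (4 * s) - ε ω ^ 2 / (8 * s) =
              (ε ω ^ 2 - B ^ 2) / (8 * s) := by field_simp; ring
            rw [this]
            exact div_nonneg (by linarith) (by positivity)
          calc ε ω ^ 2 = 8 * s * (ε ω ^ 2 / (8 * s)) := by field_simp
            _ ≤ 8 * s * (Real.exp (-B ^ 2 / (8 * s)) * Real.exp (ε ω ^ 2 / (4 * s))) := by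
                gcongr; linarith
            _ = _ := by ring
    _ ≤ 8 * s * Real.exp (-B ^ 2 / (8 * s)) * 3 := by
        rw [integral_const_mul]
        gcongr
    _ = _ := by ring

theorem integral_mul_comp_eq_zero_of_condExp {𝓧 : Type*} [MeasurableSpace 𝓧] {X : Ω → 𝓧}
    (hX : Measurable X) {ε : Ω → ℝ} (hi : Integrable ε μ)
    (hc : μ[ε | MeasurableSpace.comap X inferInstance] =ᵐ[μ] 0) {φ : 𝓧 → ℝ} (hφ : Measurable φ)
    {c : ℝ} (hb : ∀ x, |φ x| ≤ c) : ∫ ω, φ (X ω) * ε ω ∂μ = 0 := by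
  have hm : MeasurableSpace.comap X inferInstance ≤ ‹MeasurableSpace Ω› := hX.comap_le
  have h1 := condExp_stronglyMeasurable_mul_of_bound hm (μ := μ) (f := fun ω => φ (X ω)) (g := ε)
    (hφ.comp (comap_measurable X)).stronglyMeasurable hi c
    (Filter.Eventually.of_forall fun ω => hb (X ω))
  have h2 := integral_condExp hm (μ := μ) (f := (fun ω => φ (X ω)) * ε)
  rw [integral_congr_ae (g := fun _ => (0 : ℝ)), integral_zero] at h2
  · exact h2.symm
  · filter_upwards [h1, hc] with ω h3 h4
    rw [h3, Pi.mul_apply, h4, Pi.zero_apply, mul_zero]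

/-- Noise set to zero where it exceeds `B`. -/
noncomputable def truncNoise (B e : ℝ) : ℝ := if |e| ≤ B then e else 0

theorem measurable_truncNoise (B : ℝ) : Measurable (truncNoise B) :=
  Measurable.ite (measurableSet_le (by fun_prop) (by fun_prop)) measurable_id measurable_const

theorem abs_truncNoise_le {B : ℝ} (hB : 0 ≤ B) (e : ℝ) : |truncNoise B e| ≤ B := by
  rw [truncNoise]; split_ifs with h <;> simp [h, hB]

theorem mul_abs_sub_truncNoise_le (B e : ℝ) : B * |e - truncNoise B e| ≤ tailSq B e := by
  rw [truncNoise, tailSq]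
  split_ifs with h
  · simp
  · rw [sub_zero, ← sq_abs, sq]
    exact mul_le_mul_of_nonneg_right (not_le.1 h).le (abs_nonneg _)

/-- The excess loss `φ² - 2eφ` of a prediction with error `φ` under truncated noise `e`. -/
noncomputable def truncExcess (B e φ : ℝ) : ℝ := φ ^ 2 - 2 * truncNoise B e * φ

theorem neg_sq_le_truncExcess {B : ℝ} (hB : 0 ≤ B) (e φ : ℝ) : -B ^ 2 ≤ truncExcess B e φ := by
  have h := abs_truncNoise_le hB e
  have : truncNoise B e ^ 2 ≤ B ^ 2 := sq_le_sq' (abs_le.1 h).1 (abs_le.1 h).2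
  rw [truncExcess]
  nlinarith [sq_nonneg (φ - truncNoise B e)]

/-- Bernstein-type bound for the exponential moment of the truncated excess loss. -/
theorem integral_exp_neg_truncExcess_le {B : ℝ} (hB : 0 < B) {φ ε : Ω → ℝ} (hφ : Measurable φ)
    (hb : ∀ ω, |φ ω| ≤ 3 * B) (hε : Measurable ε) (hi2 : Integrable (fun ω => ε ω ^ 2) μ)
    (hi : Integrable ε μ) (horth : ∫ ω, φ ω * ε ω ∂μ = 0) {q : ℝ}
    (hq : ∫ ω, tailSq B (ε ω) ∂μ ≤ q) :
    ∫ ω, Real.exp (-(1 / (50 * B ^ 2)) * truncExcess B (ε ω) (φ ω)) ∂μ ≤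
      Real.exp (-(1 / (50 * B ^ 2)) / 2 * ∫ ω, φ ω ^ 2 ∂μ + 6 * (1 / (50 * B ^ 2)) * q) := by
  -- This `t` solves `t² (5 B)² = t / 2`: the second-order term then consumes exactly half of the
  -- first-order decay `t φ²`.
  set t := 1 / (50 * B ^ 2) with ht
  have ht0 : 0 < t := by positivity
  set ε' : Ω → ℝ := fun ω => truncNoise B (ε ω) with hε'
  have hε'm : Measurable ε' := (measurable_truncNoise B).comp hε
  have hε'b : ∀ ω, |ε' ω| ≤ B := fun ω => abs_truncNoise_le hB.le _
  have hiε' : Integrable ε' μ := Integrable.of_bound hε'm.aestronglyMeasurable B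
    (Filter.Eventually.of_forall hε'b)
  have hφ2 : Integrable (fun ω => φ ω ^ 2) μ :=
    Integrable.of_bound (by fun_prop) ((3 * B) ^ 2) (Filter.Eventually.of_forall fun ω => by
      rw [Real.norm_of_nonneg (sq_nonneg _), ← sq_abs]
      exact pow_le_pow_left₀ (abs_nonneg _) (hb ω) 2)
  have hmul : ∀ f : Ω → ℝ, Integrable f μ → Integrable (fun ω => φ ω * f ω) μ := fun f hf =>
    hf.bdd_mul hφ.aestronglyMeasurable (Filter.Eventually.of_forall hb)
  -- Truncated noise is no longer centred given `X`; `|φ| ≤ 3 B` and `B |ε - ε'| ≤ tailSq B ε` bound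
  -- the bias.
  have hbias : -(3 * q) ≤ ∫ ω, φ ω * (ε ω - ε' ω) ∂μ := by
    have h1 : |∫ ω, φ ω * (ε ω - ε' ω) ∂μ| ≤ ∫ ω, 3 * tailSq B (ε ω) ∂μ := by
      refine (abs_integral_le_integral_abs).trans (integral_mono (hmul _ (hi.sub hiε')).abs
        ((integrable_tailSq hε hi2).const_mul 3) fun ω => ?_)
      have := mul_abs_sub_truncNoise_le B (ε ω)
      simp only [abs_mul]
      calc |φ ω| * |ε ω - ε' ω| ≤ 3 * B * |ε ω - ε' ω| := by gcongr; exact hb ω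
        _ ≤ _ := by rw [mul_assoc]; gcongr
    rw [integral_const_mul] at h1
    have := (abs_le.1 h1).1
    linarith
  have hbias' : ∫ ω, φ ω * ε' ω ∂μ ≤ 3 * q := by
    simp only [mul_sub] at hbias
    rw [integral_sub (hmul _ hi) (hmul _ hiε'), horth] at hbias
    linarith
  have hZ : ∀ ω, truncExcess B (ε ω) (φ ω) = φ ω ^ 2 - 2 * (φ ω * ε' ω) := fun ω => by
    rw [truncExcess]; ring
  -- From `exp x ≤ 1 + x + x²` on `|x| ≤ 1`. The excess loss factors as `φ (φ - 2 ε')`, so its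
  -- square is at most `25 B² φ²`.
  have hpt : ∀ ω, Real.exp (-t * truncExcess B (ε ω) (φ ω)) ≤
      1 - t / 2 * φ ω ^ 2 + 2 * t * (φ ω * ε' ω) := by
    intro ω
    have hfac : truncExcess B (ε ω) (φ ω) = φ ω * (φ ω - 2 * ε' ω) := by rw [hZ]; ring
    have h5 : |φ ω - 2 * ε' ω| ≤ 5 * B := by
      have h6 := abs_le.1 (hb ω)
      have h7 := abs_le.1 (hε'b ω)
      rw [abs_le]; constructor <;> linarith
    have h8 : |-t * truncExcess B (ε ω) (φ ω)| ≤ 1 := by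
      rw [hfac, abs_mul, abs_mul, abs_neg, abs_of_pos ht0]
      calc t * (|φ ω| * |φ ω - 2 * ε' ω|) ≤ t * (3 * B * (5 * B)) := by
            gcongr; exact hb ω
        _ = 15 / 50 := by rw [ht]; field_simp; norm_num
        _ ≤ 1 := by norm_num
    have h9 := (abs_le.1 (Real.abs_exp_sub_one_sub_id_le h8)).2
    have h10 : (-t * truncExcess B (ε ω) (φ ω)) ^ 2 ≤ t / 2 * φ ω ^ 2 := by
      have h11 : (φ ω - 2 * ε' ω) ^ 2 ≤ (5 * B) ^ 2 := by
        rw [← sq_abs]; exact pow_le_pow_left₀ (abs_nonneg _) h5 2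
      calc (-t * truncExcess B (ε ω) (φ ω)) ^ 2 = t ^ 2 * φ ω ^ 2 * (φ ω - 2 * ε' ω) ^ 2 := by
            rw [hfac]; ring
        _ ≤ t ^ 2 * φ ω ^ 2 * (5 * B) ^ 2 := by gcongr
        _ = t / 2 * φ ω ^ 2 := by rw [ht]; field_simp; ring
    rw [hZ] at h9 h10 ⊢
    linarith
  have hiR : Integrable (fun ω => 1 - t / 2 * φ ω ^ 2 + 2 * t * (φ ω * ε' ω)) μ :=
    ((integrable_const 1).sub (hφ2.const_mul _)).add ((hmul _ hiε').const_mul _)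
  calc _ ≤ ∫ ω, (1 - t / 2 * φ ω ^ 2 + 2 * t * (φ ω * ε' ω)) ∂μ :=
        integral_mono_of_nonneg (Filter.Eventually.of_forall fun ω => (Real.exp_pos _).le) hiR
          (Filter.Eventually.of_forall hpt)
    _ = 1 - t / 2 * ∫ ω, φ ω ^ 2 ∂μ + 2 * t * ∫ ω, φ ω * ε' ω ∂μ := by
        have i1 : Integrable (fun ω => 1 - t / 2 * φ ω ^ 2) μ :=
          (integrable_const 1).sub (hφ2.const_mul _)
        rw [integral_add i1 ((hmul _ hiε').const_mul _),
          integral_sub (integrable_const 1) (hφ2.const_mul _), integral_const_mul,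
          integral_const_mul]
        simp
    _ ≤ (-t / 2 * ∫ ω, φ ω ^ 2 ∂μ + 6 * t * q) + 1 := by
        have := mul_le_mul_of_nonneg_left hbias' (by positivity : 0 ≤ 2 * t)
        linarith
    _ ≤ _ := Real.add_one_le_exp _

end SubGaussian

/-! ### Product integrals with frozen coordinates -/

section Pi

variable {ι E : Type*} [DecidableEq ι] [MeasurableSpace E] (ν : ι → Measure E)
  [∀ i, IsProbabilityMeasure (ν i)]

/-- Once the coordinates in `S` are fixed, each coordinate of `s` enters a single factor and
integrates separately. The prefactor `k` is general so that the induction can absorb into it the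
factor just integrated. -/
theorem lmarginal_mul_prod (S : Finset ι) (h : ι → (ι → E) → E → ℝ≥0∞)
    (hm : ∀ i, Measurable fun p : (ι → E) × E => h i p.1 p.2)
    (hS : ∀ i z z', (∀ j ∈ S, z j = z' j) → h i z = h i z') (s : Finset ι) :
    ∀ k : (ι → E) → ℝ≥0∞, Measurable k → (∀ z z', (∀ j ∈ S, z j = z' j) → k z = k z') →
      Disjoint s S →
      (∫⋯∫⁻_s, (fun z => k z * ∏ i ∈ s, h i z (z i)) ∂ν) =
        fun z => k z * ∏ i ∈ s, ∫⁻ e, h i z e ∂ν i := by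
  induction s using Finset.induction_on with
  | empty => intro k _ _ _; simp
  | insert i s his ih =>
    intro k hk hkS hd
    rw [Finset.disjoint_insert_left] at hd
    have hupd : ∀ (z : ι → E) (e : E), ∀ j ∈ S, Function.update z i e j = z j := fun z e j hj =>
      Function.update_of_ne (fun h' : j = i => hd.1 (h' ▸ hj)) e z
    have hmz : ∀ j, Measurable fun z : ι → E => h j z (z j) := fun j =>
      (hm j).comp (measurable_id.prodMk (measurable_pi_apply j))
    have hfm : Measurable fun z => k z * ∏ j ∈ insert i s, h j z (z j) :=
      hk.mul (Finset.measurable_prod _ fun j _ => hmz j)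
    rw [lmarginal_insert' _ hfm his]
    have e1 : (fun z => ∫⁻ e, (fun z => k z * ∏ j ∈ insert i s, h j z (z j))
        (Function.update z i e) ∂ν i) =
        fun z => (k z * ∫⁻ e, h i z e ∂ν i) * ∏ j ∈ s, h j z (z j) := by
      ext z
      have : ∀ e, (fun z => k z * ∏ j ∈ insert i s, h j z (z j)) (Function.update z i e) =
          (k z * ∏ j ∈ s, h j z (z j)) * h i z e := by
        intro e
        simp only
        rw [hkS _ _ (hupd z e), Finset.prod_insert his, hS i _ _ (hupd z e),
          Function.update_self, Finset.prod_congr rfl fun j hj => by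
            rw [hS j _ _ (hupd z e), Function.update_of_ne (fun h' : j = i => his (h' ▸ hj))]]
        ring
      simp only [this]
      rw [lintegral_const_mul _ (f := h i z) (hm i).of_uncurry_left]
      ring
    rw [e1, ih (fun z => k z * ∫⁻ e, h i z e ∂ν i) (hk.mul (hm i).lintegral_prod_right')
      (fun z z' hz => by simp only [hkS z z' hz, hS i z z' hz]) hd.2]
    ext z
    rw [Finset.prod_insert his]
    ring

variable [Fintype ι]

/-- Integration over a product space of a product whose factors depend on a set `S` of coordinates
and one coordinate outside `S` each. -/
theorem lintegral_pi_mul_prod_le (S : Finset ι) (h : ι → (ι → E) → E → ℝ≥0∞)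
    (hm : ∀ i, Measurable fun p : (ι → E) × E => h i p.1 p.2)
    (hS : ∀ i z z', (∀ j ∈ S, z j = z' j) → h i z = h i z')
    (k : (ι → E) → ℝ≥0∞) (hk : Measurable k)
    (hkS : ∀ z z', (∀ j ∈ S, z j = z' j) → k z = k z') {C : ℝ≥0∞}
    (hC : ∀ z, k z * ∏ i ∈ Sᶜ, ∫⁻ e, h i z e ∂ν i ≤ C) :
    ∫⁻ z, k z * ∏ i ∈ Sᶜ, h i z (z i) ∂Measure.pi ν ≤ C := by
  have hmz : ∀ j, Measurable fun z : ι → E => h j z (z j) := fun j =>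
    (hm j).comp (measurable_id.prodMk (measurable_pi_apply j))
  rcases isEmpty_or_nonempty (ι → E) with he | ⟨⟨z₀⟩⟩
  · simp
  have hfm : Measurable fun z => k z * ∏ i ∈ Sᶜ, h i z (z i) :=
    hk.mul (Finset.measurable_prod _ fun j _ => hmz j)
  have h1 := congrFun (lmarginal_univ (μ := ν) (f := fun z => k z * ∏ i ∈ Sᶜ, h i z (z i))) z₀
  rw [← h1, ← Finset.union_compl S,
    lmarginal_union ν _ hfm disjoint_compl_right,
    lmarginal_mul_prod ν S h hm hS _ k hk hkS disjoint_compl_left]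
  refine (lmarginal_mono (g := fun _ => C) hC z₀).trans ?_
  simp [lmarginal]

end Pi

/-! ### Exponential moment of the gap for a rule using few observations -/

section ExpMoment

variable {Ω : Type*} [MeasurableSpace Ω] {μ : Measure Ω} [IsProbabilityMeasure μ] {n : ℕ}
  {𝓧 : Type*} [MeasurableSpace 𝓧]

set_option maxHeartbeats 1000000 in
/-- Exponential moment of the generalization gap of a prediction rule that depends on the
observations in `S` only. -/
theorem lintegral_exp_gap_le {P : Measure 𝓧} [IsProbabilityMeasure P] {X : Fin n → Ω → 𝓧}
    {ε : Fin n → Ω → ℝ} (hX : ∀ i, Measurable (X i)) (hε : ∀ i, Measurable (ε i))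
    (hP : ∀ i, μ.map (X i) = P) (hind : iIndepFun (fun i ω => (X i ω, ε i ω)) μ)
    (hi2 : ∀ i, Integrable (fun ω => ε i ω ^ 2) μ) (hi : ∀ i, Integrable (ε i) μ)
    (horth : ∀ i, ∀ φ : 𝓧 → ℝ, Measurable φ → ∀ c, (∀ x, |φ x| ≤ c) →
      ∫ ω, φ (X i ω) * ε i ω ∂μ = 0) {B q : ℝ} (hB : 0 < B)
    (hq0 : 0 ≤ q) (hq : ∀ i, ∫ ω, tailSq B (ε i ω) ∂μ ≤ q) (S : Finset (Fin n))
    (φ : (Fin n → 𝓧) → 𝓧 → ℝ) (hφ : Measurable fun p : (Fin n → 𝓧) × 𝓧 => φ p.1 p.2)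
    (hφb : ∀ z x, |φ z x| ≤ 3 * B) (hφS : ∀ z z', (∀ j ∈ S, z j = z' j) → φ z = φ z') :
    ∫⁻ ω, ENNReal.ofReal (Real.exp
      (n * (1 / (50 * B ^ 2)) / 2 * ∫ x, φ (fun i => X i ω) x ^ 2 ∂P -
        1 / (50 * B ^ 2) * ∑ i, truncExcess B (ε i ω) (φ (fun i => X i ω) (X i ω)))) ∂μ ≤
      ENNReal.ofReal (Real.exp (S.card + 6 * n * (1 / (50 * B ^ 2)) * q)) := by
  set t := 1 / (50 * B ^ 2) with ht
  have ht0 : 0 < t := by positivity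
  set ν : Fin n → Measure (𝓧 × ℝ) := fun i => μ.map fun ω => (X i ω, ε i ω) with hν
  have hXε : ∀ i, Measurable fun ω => (X i ω, ε i ω) := fun i => (hX i).prodMk (hε i)
  have hνp : ∀ i, IsProbabilityMeasure (ν i) := fun i =>
    Measure.isProbabilityMeasure_map (hXε i).aemeasurable
  have hlaw : μ.map (fun ω i => (X i ω, ε i ω)) = Measure.pi ν :=
    (iIndepFun_iff_map_fun_eq_pi_map fun i => (hXε i).aemeasurable).1 hind
  set ψ : (Fin n → 𝓧 × ℝ) → 𝓧 → ℝ := fun z => φ fun i => (z i).1 with hψ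
  have hψm : Measurable fun p : (Fin n → 𝓧 × ℝ) × 𝓧 => ψ p.1 p.2 := by
    refine hφ.comp (Measurable.prodMk (measurable_pi_lambda _ fun i => ?_) measurable_snd)
    exact ((measurable_pi_apply i).comp measurable_fst).fst
  have hψS : ∀ z z', (∀ j ∈ S, z j = z' j) → ψ z = ψ z' := fun z z' h =>
    hφS _ _ fun j hj => by rw [h j hj]
  have hexm : Measurable fun p : ℝ × ℝ => truncExcess B p.1 p.2 := by
    have := (measurable_truncNoise B).comp (measurable_fst : Measurable (Prod.fst : ℝ × ℝ → ℝ))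
    simp only [truncExcess]
    exact (measurable_snd.pow_const 2).sub ((this.const_mul 2).mul measurable_snd)
  set D : (Fin n → 𝓧 × ℝ) → ℝ := fun z => ∫ x, ψ z x ^ 2 ∂P with hD
  have hDm : Measurable D :=
    ((hψm.pow_const 2).stronglyMeasurable.integral_prod_right (ν := P)).measurable
  have hD9 : ∀ z, D z ≤ 9 * B ^ 2 := by
    intro z
    calc D z ≤ ∫ _x, 9 * B ^ 2 ∂P := by
          refine integral_mono_of_nonneg (Filter.Eventually.of_forall fun x => sq_nonneg _)
            (integrable_const _) (Filter.Eventually.of_forall fun x => ?_)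
          have := pow_le_pow_left₀ (abs_nonneg _) (hφb (fun i => (z i).1) x) 2
          rw [sq_abs] at this
          calc _ ≤ _ := this
            _ = _ := by ring
      _ = 9 * B ^ 2 := by simp
  set h : Fin n → (Fin n → 𝓧 × ℝ) → 𝓧 × ℝ → ℝ≥0∞ := fun _ z e =>
    ENNReal.ofReal (Real.exp (-t * truncExcess B e.2 (ψ z e.1))) with hh
  have hhm : ∀ i, Measurable fun p : (Fin n → 𝓧 × ℝ) × (𝓧 × ℝ) => h i p.1 p.2 := by
    intro i
    have h1 : Measurable fun p : (Fin n → 𝓧 × ℝ) × (𝓧 × ℝ) => ψ p.1 p.2.1 :=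
      hψm.comp (measurable_fst.prodMk measurable_snd.fst)
    have h2 : Measurable fun p : (Fin n → 𝓧 × ℝ) × (𝓧 × ℝ) => truncExcess B p.2.2 (ψ p.1 p.2.1) :=
      hexm.comp (measurable_snd.snd.prodMk h1)
    exact (Real.measurable_exp.comp (h2.const_mul (-t))).ennreal_ofReal
  set k : (Fin n → 𝓧 × ℝ) → ℝ≥0∞ := fun z =>
    ENNReal.ofReal (Real.exp (n * t / 2 * D z + t * (S.card * B ^ 2))) with hk
  have hkm : Measurable k :=
    (Real.measurable_exp.comp ((hDm.const_mul (n * t / 2)).add_const _)).ennreal_ofReal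
  have hone : ∀ i z, ∫⁻ e, h i z e ∂ν i ≤
      ENNReal.ofReal (Real.exp (-t / 2 * D z + 6 * t * q)) := by
    intro i z
    have hψz : Measurable (ψ z) := hψm.comp measurable_prodMk_left
    have hhz : Measurable (h i z) := (hhm i).of_uncurry_left
    rw [hν, lintegral_map hhz (hXε i)]
    have hmeas : Measurable fun ω => truncExcess B (ε i ω) (ψ z (X i ω)) :=
      hexm.comp ((hε i).prodMk (hψz.comp (hX i)))
    have hint : Integrable
        (fun ω => Real.exp (-t * truncExcess B (ε i ω) (ψ z (X i ω)))) μ := by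
      refine Integrable.of_bound (Real.measurable_exp.comp
        (hmeas.const_mul (-t))).aestronglyMeasurable (Real.exp (t * B ^ 2))
        (Filter.Eventually.of_forall fun ω => ?_)
      rw [Real.norm_of_nonneg (Real.exp_pos _).le, Real.exp_le_exp]
      have := neg_sq_le_truncExcess hB.le (ε i ω) (ψ z (X i ω))
      nlinarith
    simp only [hh]
    rw [← ofReal_integral_eq_lintegral_ofReal hint
      (Filter.Eventually.of_forall fun ω => (Real.exp_pos _).le)]
    refine ENNReal.ofReal_le_ofReal ?_
    have := integral_exp_neg_truncExcess_le hB (φ := fun ω => ψ z (X i ω)) (ε := ε i) (μ := μ)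
      (hψz.comp (hX i)) (fun ω => hφb _ _) (hε i) (hi2 i) (hi i)
      (horth i (ψ z) hψz (3 * B) fun x => hφb _ _) (hq i)
    rw [← ht] at this
    have e : ∫ ω, ψ z (X i ω) ^ 2 ∂μ = D z := by
      simp only [hD]
      rw [← hP i, integral_map (hX i).aemeasurable (hψz.pow_const 2).aestronglyMeasurable]
    rwa [e] at this
  have hmain := lintegral_pi_mul_prod_le ν S h hhm (fun i z z' hz => by
      simp only [hh, hψS z z' hz]) k hkm (fun z z' hz => by simp only [hk, hD, hψS z z' hz])
    (C := ENNReal.ofReal (Real.exp (S.card + 6 * n * t * q))) (fun z => by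
      calc k z * ∏ i ∈ Sᶜ, ∫⁻ e, h i z e ∂ν i
          ≤ k z * ∏ _i ∈ Sᶜ, ENNReal.ofReal (Real.exp (-t / 2 * D z + 6 * t * q)) := by
            gcongr with i hi'
            exact hone i z
        _ = ENNReal.ofReal (Real.exp (n * t / 2 * D z + t * (S.card * B ^ 2) +
              (Sᶜ.card : ℝ) * (-t / 2 * D z + 6 * t * q))) := by
            rw [Finset.prod_const, ← ENNReal.ofReal_pow (Real.exp_pos _).le, ← Real.exp_nat_mul,
              hk, ← ENNReal.ofReal_mul (Real.exp_pos _).le, ← Real.exp_add]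
        _ ≤ _ := by
            refine ENNReal.ofReal_le_ofReal (Real.exp_le_exp.2 ?_)
            have hc : (Sᶜ.card : ℝ) = n - S.card := by
              rw [Finset.card_compl, Fintype.card_fin, Nat.cast_sub]
              simpa using S.card_le_univ
            have hs0 : (0 : ℝ) ≤ S.card := Nat.cast_nonneg _
            have htB : t * B ^ 2 = 1 / 50 := by rw [ht]; field_simp
            -- Each frozen observation costs `t B² = 1 / 50` for its own loss and `t D / 2 ≤ 9 /
            -- 100` for its missing factor, together less than 1.
            have h1 : (S.card : ℝ) * (t * D z) ≤ S.card * (9 / 50) := by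
              have : t * D z ≤ 9 / 50 := by
                calc t * D z ≤ t * (9 * B ^ 2) := by gcongr; exact hD9 z
                  _ = 9 * (t * B ^ 2) := by ring
                  _ = 9 / 50 := by rw [htB]; norm_num
              gcongr
            have h2 : 0 ≤ (S.card : ℝ) * (t * q) := by positivity
            have h3 : t * (S.card * B ^ 2) = S.card * (1 / 50) := by rw [← htB]; ring
            rw [hc, h3]
            nlinarith)
  have hfm : Measurable fun z => k z * ∏ i ∈ Sᶜ, h i z (z i) :=
    hkm.mul (Finset.measurable_prod _ fun j _ =>
      (hhm j).comp (measurable_id.prodMk (measurable_pi_apply j)))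
  rw [← hlaw, lintegral_map hfm (measurable_pi_lambda _ hXε)] at hmain
  refine le_trans (lintegral_mono fun ω => ?_) hmain
  simp only [hk, hh, hD, hψ]
  rw [← ENNReal.ofReal_prod_of_nonneg fun i _ => (Real.exp_pos _).le, ← Real.exp_sum,
    ← ENNReal.ofReal_mul (Real.exp_pos _).le, ← Real.exp_add]
  refine ENNReal.ofReal_le_ofReal (Real.exp_le_exp.2 ?_)
  rw [← Finset.sum_add_sum_compl S, ← Finset.mul_sum]
  -- The losses at the frozen observations are not independent of the rule, so only their
  -- deterministic lower bound is used.
  have hlow : -(S.card * B ^ 2) ≤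
      ∑ i ∈ S, truncExcess B (ε i ω) (φ (fun i => X i ω) (X i ω)) := by
    calc -(S.card * B ^ 2) = ∑ _i ∈ S, -B ^ 2 := by rw [Finset.sum_const, nsmul_eq_mul]; ring
      _ ≤ _ := Finset.sum_le_sum fun i _ => neg_sq_le_truncExcess hB.le _ _
  nlinarith

end ExpMoment

/-! ### Tangent bound for the logarithm, regularity of additive functions, perturbation of squares
-/

/-- The tangent to the logarithm at `A`. It lets the gap of the code selected by the data be bounded
by a fixed sum of exponentials over all codes, whose expectation is known. -/
theorem Real.le_log_add_exp_div_sub_one {A : ℝ} (hA : 0 < A) (u : ℝ) :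
    u ≤ Real.log A + Real.exp u / A - 1 := by
  have h := Real.add_one_le_exp (u - Real.log A)
  rw [Real.exp_sub, Real.exp_log hA] at h
  linarith

theorem eVariationOn.measurable_of_ne_top {f : ℝ → ℝ} (hf : eVariationOn f Set.univ ≠ ⊤) :
    Measurable f := by
  have h : LocallyBoundedVariationOn f Set.univ :=
    BoundedVariationOn.locallyBoundedVariationOn hf
  obtain ⟨p, q, hp, hq, rfl⟩ := h.exists_monotoneOn_sub_monotoneOn
  exact (monotoneOn_univ.1 hp).measurable.sub (monotoneOn_univ.1 hq).measurable

section Additive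

variable {d₁ d₂ : ℕ} {g : Tensor d₁ d₂ → ℝ} {h : Fin d₁ → Fin d₂ → ℝ → ℝ}

theorem IsAdditiveRep.measurable (hg : IsAdditiveRep g h)
    (hh : ∀ i₁ i₂, eVariationOn (h i₁ i₂) Set.univ ≠ ⊤) : Measurable g := by
  have e : g = fun x => ∑ i₂, ∑ i₁, h i₁ i₂ (x i₁ i₂) := funext hg
  rw [e]
  refine Finset.measurable_sum _ fun i₂ _ => Finset.measurable_sum _ fun i₁ _ => ?_
  exact (eVariationOn.measurable_of_ne_top (hh i₁ i₂)).comp (by fun_prop)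

theorem IsAdditiveRep.exists_abs_le (hg : IsAdditiveRep g h)
    (hh : ∀ i₁ i₂, eVariationOn (h i₁ i₂) Set.univ ≠ ⊤) : ∃ c, ∀ x, |g x| ≤ c := by
  refine ⟨∑ i₂, ∑ i₁, (|h i₁ i₂ 0| + (eVariationOn (h i₁ i₂) Set.univ).toReal), fun x => ?_⟩
  rw [hg x]
  refine (Finset.abs_sum_le_sum_abs _ _).trans (Finset.sum_le_sum fun i₂ _ => ?_)
  refine (Finset.abs_sum_le_sum_abs _ _).trans (Finset.sum_le_sum fun i₁ _ => ?_)
  have h1 := ENNReal.toReal_mono (hh i₁ i₂)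
    (eVariationOn.edist_le (h i₁ i₂) (Set.mem_univ (x i₁ i₂)) (Set.mem_univ 0))
  rw [edist_dist, Real.dist_eq, ENNReal.toReal_ofReal (abs_nonneg _)] at h1
  have h2 := abs_add_le (h i₁ i₂ (x i₁ i₂) - h i₁ i₂ 0) (h i₁ i₂ 0)
  rw [sub_add_cancel] at h2
  linarith

end Additive

theorem integral_sq_sub_le {𝓧 : Type*} [MeasurableSpace 𝓧] {P : Measure 𝓧}
    [IsProbabilityMeasure P] {u v : 𝓧 → ℝ} (hv : Integrable (fun x => v x ^ 2) P) {c δ : ℝ}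
    (huv : ∀ x, |u x + v x| ≤ c) (hδ : ∀ x, |u x - v x| ≤ δ) :
    ∫ x, u x ^ 2 ∂P ≤ ∫ x, v x ^ 2 ∂P + δ * c := by
  calc ∫ x, u x ^ 2 ∂P ≤ ∫ x, (v x ^ 2 + δ * c) ∂P := by
        refine integral_mono_of_nonneg (Filter.Eventually.of_forall fun x => sq_nonneg _)
          (hv.add (integrable_const _)) (Filter.Eventually.of_forall fun x => ?_)
        have h1 : |(u x - v x) * (u x + v x)| ≤ δ * c := by
          rw [abs_mul]
          exact mul_le_mul (hδ x) (huv x) (abs_nonneg _) ((abs_nonneg _).trans (hδ x))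
        have h2 := (le_abs_self _).trans h1
        simp only
        linarith
    _ = _ := by rw [integral_add hv (integrable_const _)]; simp

/-! ### Population error against training error, sample by sample -/

section Gap

variable {n d₁ d₂ K : ℕ}

/-- The prediction error of a code with leaf values on a grid of `[-2B, 2B]`. -/
noncomputable def codeError (gstar : Tensor d₁ d₂ → ℝ) (B : ℝ)
    (θ : TreeCode n d₁ d₂ (n + 1) K) (X : Fin n → Tensor d₁ d₂) (x : Tensor d₁ d₂) : ℝ :=
  θ.eval (uniformGrid n (2 * B)) X x - gstar x

/-- The scaled generalization gap of a code. -/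
noncomputable def codeGap (P : Measure (Tensor d₁ d₂)) (gstar : Tensor d₁ d₂ → ℝ) (B : ℝ)
    (X : Fin n → Tensor d₁ d₂) (ε : Fin n → ℝ) (θ : TreeCode n d₁ d₂ (n + 1) K) : ℝ :=
  n * (1 / (50 * B ^ 2)) / 2 * ∫ x, codeError gstar B θ X x ^ 2 ∂P -
    1 / (50 * B ^ 2) * ∑ i, truncExcess B (ε i) (codeError gstar B θ X (X i))

theorem measurable_codeError {gstar : Tensor d₁ d₂ → ℝ} (hg : Measurable gstar) (B : ℝ)
    (θ : TreeCode n d₁ d₂ (n + 1) K) :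
    Measurable fun p : (Fin n → Tensor d₁ d₂) × Tensor d₁ d₂ => codeError gstar B θ p.1 p.2 :=
  (θ.measurable_eval _).sub (hg.comp measurable_snd)

theorem abs_codeError_le (hn : 0 < n) {gstar : Tensor d₁ d₂ → ℝ} {B : ℝ} (hB : 0 ≤ B)
    (hg : ∀ x, |gstar x| ≤ B) (θ : TreeCode n d₁ d₂ (n + 1) K) (X : Fin n → Tensor d₁ d₂)
    (x : Tensor d₁ d₂) : |codeError gstar B θ X x| ≤ 3 * B := by
  have h1 := θ.abs_eval_le (uniformGrid n (2 * B))
    (abs_uniformGrid_le hn (by positivity : 0 ≤ 2 * B)) X x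
  have h2 := hg x
  rw [abs_le] at *
  rw [codeError]
  constructor <;> linarith

theorem measurable_codeGap (P : Measure (Tensor d₁ d₂)) [IsProbabilityMeasure P]
    {gstar : Tensor d₁ d₂ → ℝ} (hg : Measurable gstar) (B : ℝ)
    (θ : TreeCode n d₁ d₂ (n + 1) K) {Ω : Type*} [MeasurableSpace Ω]
    {X : Fin n → Ω → Tensor d₁ d₂} {ε : Fin n → Ω → ℝ} (hX : ∀ i, Measurable (X i))
    (hε : ∀ i, Measurable (ε i)) :
    Measurable fun ω => codeGap P gstar B (fun i => X i ω) (fun i => ε i ω) θ := by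
  have hXm : Measurable fun ω i => X i ω := measurable_pi_lambda _ hX
  have h1 : Measurable fun X' : Fin n → Tensor d₁ d₂ => ∫ x, codeError gstar B θ X' x ^ 2 ∂P :=
    (((measurable_codeError hg B θ).pow_const 2).stronglyMeasurable.integral_prod_right
      (ν := P)).measurable
  have h2 : ∀ i, Measurable fun ω =>
      truncExcess B (ε i ω) (codeError gstar B θ (fun i => X i ω) (X i ω)) := by
    intro i
    have h3 : Measurable fun ω => codeError gstar B θ (fun i => X i ω) (X i ω) :=
      (measurable_codeError hg B θ).comp (hXm.prodMk (hX i))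
    have h4 := (measurable_truncNoise B).comp (hε i)
    exact (h3.pow_const 2).sub ((h4.const_mul 2).mul h3)
  exact ((h1.comp hXm).const_mul _).sub ((Finset.measurable_sum _ fun i _ => h2 i).const_mul _)

/-- Pointwise comparison of the population error and the training error of a greedy tree. -/
theorem IsSSETree.integral_sq_le (hn : 0 < n) (h₁ : 0 < d₁) (h₂ : 0 < d₂)
    (P : Measure (Tensor d₁ d₂)) [IsProbabilityMeasure P]
    {gstar : Tensor d₁ d₂ → ℝ} (hgm : Measurable gstar) {B : ℝ} (hB : 0 < B)
    (hg : ∀ x, |gstar x| ≤ B) (X : Fin n → Tensor d₁ d₂) (ε : Fin n → ℝ) {t : TensorTree d₁ d₂}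
    {I : Finset (Fin n)} (ht : IsSSETree X (fun i => gstar (X i) + ε i) K I t) {A : ℝ}
    (hA : Real.exp 1 ≤ A) :
    ∫ x, (gstar x - t.eval x) ^ 2 ∂P ≤
      2 / n * ∑ i, ((gstar (X i) + ε i - t.eval (X i)) ^ 2 - ε i ^ 2) +
        100 * B ^ 2 / n * (Real.log A +
          (∑ θ : TreeCode n d₁ d₂ (n + 1) K, Real.exp (codeGap P gstar B X ε θ)) / A - 1) +
        88 * B ^ 2 / n + 11 * ∑ i, tailSq B (ε i) := by
  have hn' : (0 : ℝ) < n := by exact_mod_cast hn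
  have hA0 : 0 < A := (Real.exp_pos 1).trans_le hA
  have hlogA : 1 ≤ Real.log A := (Real.le_log_iff_exp_le hA0).2 hA
  have htail : 0 ≤ ∑ i, tailSq B (ε i) := Finset.sum_nonneg fun i _ => tailSq_nonneg _ _
  by_cases hgood : ∀ i, |ε i| ≤ B
  · have hy : ∀ i, |gstar (X i) + ε i| ≤ 2 * B := fun i =>
      (abs_add_le _ _).trans (by linarith [hg (X i), hgood i])
    have htb : ∀ x, |t.eval x| ≤ 2 * B := fun x =>
      ht.abs_eval_le (by positivity) hy x K I t
    obtain ⟨θ, hθ⟩ := IsSSETree.exists_code (δ := 2 * (2 * B) / n) (by positivity) hy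
      (uniformGrid n (2 * B))
      (fun c hc => exists_abs_sub_uniformGrid_le hn (by positivity : 0 < 2 * B) hc)
      ⟨0, hn⟩ ⟨0, h₁⟩ ⟨0, h₂⟩ K I t ht
    set D := ∫ x, codeError gstar B θ X x ^ 2 ∂P with hD
    have hcm : Measurable (codeError gstar B θ X) :=
      (measurable_codeError hgm B θ).of_uncurry_left
    have hcb := abs_codeError_le hn hB.le hg θ X
    have hci : Integrable (fun x => codeError gstar B θ X x ^ 2) P :=
      Integrable.of_bound (hcm.pow_const 2).aestronglyMeasurable ((3 * B) ^ 2)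
        (Filter.Eventually.of_forall fun x => by
          rw [Real.norm_of_nonneg (sq_nonneg _), ← sq_abs]
          exact pow_le_pow_left₀ (abs_nonneg _) (hcb x) 2)
    have hD1 : ∫ x, (gstar x - t.eval x) ^ 2 ∂P ≤ D + 2 * (2 * B) / n * (6 * B) := by
      have e : ∀ x, (gstar x - t.eval x) ^ 2 = (t.eval x - gstar x) ^ 2 := fun x => by ring
      simp only [e]
      refine integral_sq_sub_le hci (fun x => ?_) (fun x => ?_)
      · have h3 := abs_le.1 (hcb x)
        have h4 := abs_le.1 (hg x)
        have h5 := abs_le.1 (htb x)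
        rw [abs_le]; constructor <;> linarith
      · have := hθ x
        rw [codeError]
        convert this using 2
        ring
    have hgap : codeGap P gstar B X ε θ = n / (100 * B ^ 2) *
        (D - 2 / n * ∑ i, truncExcess B (ε i) (codeError gstar B θ X (X i))) := by
      rw [codeGap, ← hD]
      field_simp
      ring
    have hsum : ∑ i, truncExcess B (ε i) (codeError gstar B θ X (X i)) ≤
        ∑ i, ((gstar (X i) + ε i - t.eval (X i)) ^ 2 - ε i ^ 2) + 32 * B ^ 2 := by
      have : ∀ i, truncExcess B (ε i) (codeError gstar B θ X (X i)) ≤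
          ((gstar (X i) + ε i - t.eval (X i)) ^ 2 - ε i ^ 2) + 2 * (2 * B) / n * (8 * B) := by
        intro i
        rw [truncExcess, truncNoise, if_pos (hgood i), codeError]
        have h3 := abs_le.1 (hy i)
        have h4 := abs_le.1 (htb (X i))
        have h5 := abs_le.1 (θ.abs_eval_le (uniformGrid n (2 * B))
          (abs_uniformGrid_le hn (by positivity : 0 ≤ 2 * B)) X (X i))
        set a := t.eval (X i)
        set c := θ.eval (uniformGrid n (2 * B)) X (X i)
        have h6 : |(a - c) * (2 * (gstar (X i) + ε i) - a - c)| ≤ 2 * (2 * B) / n * (8 * B) := by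
          rw [abs_mul]
          refine mul_le_mul (hθ (X i)) ?_ (abs_nonneg _) (by positivity)
          rw [abs_le]; constructor <;> linarith
        have h7 := (le_abs_self _).trans h6
        linarith
      calc _ ≤ ∑ i, (((gstar (X i) + ε i - t.eval (X i)) ^ 2 - ε i ^ 2) +
            2 * (2 * B) / n * (8 * B)) := Finset.sum_le_sum fun i _ => this i
        _ = _ := by
            rw [Finset.sum_add_distrib, Finset.sum_const, Finset.card_univ, Fintype.card_fin,
              nsmul_eq_mul]
            field_simp
            ring
    have hu : codeGap P gstar B X ε θ ≤ Real.log A +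
        (∑ θ : TreeCode n d₁ d₂ (n + 1) K, Real.exp (codeGap P gstar B X ε θ)) / A - 1 := by
      refine (Real.le_log_add_exp_div_sub_one hA0 _).trans ?_
      have : Real.exp (codeGap P gstar B X ε θ) ≤
          ∑ θ : TreeCode n d₁ d₂ (n + 1) K, Real.exp (codeGap P gstar B X ε θ) :=
        Finset.single_le_sum (f := fun θ => Real.exp (codeGap P gstar B X ε θ))
          (fun _ _ => (Real.exp_pos _).le) (Finset.mem_univ θ)
      gcongr
    rw [hgap] at hu
    have hu' := mul_le_mul_of_nonneg_left hu (by positivity : 0 ≤ 100 * B ^ 2 / (n : ℝ))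
    rw [← mul_assoc, show 100 * B ^ 2 / (n : ℝ) * (n / (100 * B ^ 2)) = 1 by field_simp,
      one_mul] at hu'
    have hs' := mul_le_mul_of_nonneg_left hsum (by positivity : 0 ≤ 2 / (n : ℝ))
    -- The rounding cost of the grid, of mesh `4 B / n`: 24 from the population error and 64 from
    -- the training error.
    have e1 : 2 * (2 * B) / n * (6 * B) + 2 / (n : ℝ) * (32 * B ^ 2) = 88 * B ^ 2 / n := by
      field_simp; ring
    linarith
  -- Some noise exceeds `B`. With `m` the largest noise, the tree is bounded by `2 m`, so the error
  -- is at most `9 m²` and the training term at least `-2 m²`; the sum of `tailSq` is at least `m²`,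
  -- hence the coefficient 11. The logarithmic term is nonnegative because `log A ≥ 1`.
  · push Not at hgood
    obtain ⟨i₁, hi₁⟩ := hgood
    obtain ⟨i₀, -, hi₀⟩ := Finset.exists_max_image Finset.univ (fun i => |ε i|)
      ⟨i₁, Finset.mem_univ _⟩
    set m := |ε i₀| with hm
    have hmB : B < m := hi₁.trans_le (hi₀ i₁ (Finset.mem_univ _))
    have hm0 : 0 < m := hB.trans hmB
    have hmax : ∀ i, |ε i| ≤ m := fun i => hi₀ i (Finset.mem_univ _)
    have hy : ∀ i, |gstar (X i) + ε i| ≤ 2 * m := fun i =>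
      (abs_add_le _ _).trans (by linarith [hg (X i), hmax i])
    have htb : ∀ x, |t.eval x| ≤ 2 * m := fun x => ht.abs_eval_le (by positivity) hy x K I t
    have h3 : ∫ x, (gstar x - t.eval x) ^ 2 ∂P ≤ 9 * m ^ 2 := by
      calc _ ≤ ∫ _x, 9 * m ^ 2 ∂P := by
            refine integral_mono_of_nonneg (Filter.Eventually.of_forall fun x => sq_nonneg _)
              (integrable_const _) (Filter.Eventually.of_forall fun x => ?_)
            have h4 := abs_le.1 (hg x)
            have h5 := abs_le.1 (htb x)
            have : (gstar x - t.eval x) ^ 2 ≤ (3 * m) ^ 2 :=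
              sq_le_sq' (by linarith) (by linarith)
            simp only
            linarith
        _ = _ := by simp
    have h4 : m ^ 2 ≤ ∑ i, tailSq B (ε i) := by
      refine le_trans (le_of_eq ?_) (Finset.single_le_sum (f := fun i => tailSq B (ε i))
        (fun i _ => tailSq_nonneg _ _) (Finset.mem_univ i₀))
      simp only [tailSq]
      rw [if_neg (not_le.2 hmB), hm, sq_abs]
    have h5 : -(2 * m ^ 2) ≤
        2 / n * ∑ i, ((gstar (X i) + ε i - t.eval (X i)) ^ 2 - ε i ^ 2) := by
      have : -(n * m ^ 2) ≤ ∑ i, ((gstar (X i) + ε i - t.eval (X i)) ^ 2 - ε i ^ 2) := by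
        calc -(n * m ^ 2) = ∑ _i : Fin n, -m ^ 2 := by simp
          _ ≤ _ := Finset.sum_le_sum fun i _ => by
            have h6 : ε i ^ 2 ≤ m ^ 2 := by
              rw [← sq_abs]; exact pow_le_pow_left₀ (abs_nonneg _) (hmax i) 2
            have := sq_nonneg (gstar (X i) + ε i - t.eval (X i))
            linarith
      have h7 := mul_le_mul_of_nonneg_left this (by positivity : 0 ≤ 2 / (n : ℝ))
      have e : 2 / (n : ℝ) * -(n * m ^ 2) = -(2 * m ^ 2) := by field_simp
      linarith
    have h6 : 0 ≤ 100 * B ^ 2 / n * (Real.log A +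
        (∑ θ : TreeCode n d₁ d₂ (n + 1) K, Real.exp (codeGap P gstar B X ε θ)) / A - 1) := by
      have : 0 ≤ (∑ θ : TreeCode n d₁ d₂ (n + 1) K, Real.exp (codeGap P gstar B X ε θ)) / A :=
        div_nonneg (Finset.sum_nonneg fun _ _ => (Real.exp_pos _).le) hA0.le
      have h8 : 0 ≤ 100 * B ^ 2 / (n : ℝ) := by positivity
      exact mul_nonneg h8 (by linarith)
    have h7 : 0 ≤ 88 * B ^ 2 / (n : ℝ) := by positivity
    linarith

end Gap

/-! ### Oracle inequality in expectation -/

section Oracle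

variable {n d₁ d₂ K : ℕ} {Ω : Type*} [MeasurableSpace Ω] {μ : Measure Ω} [IsProbabilityMeasure μ]

theorem integrable_exp_codeGap (hn : 0 < n) {P : Measure (Tensor d₁ d₂)} [IsProbabilityMeasure P]
    {gstar : Tensor d₁ d₂ → ℝ} (hgm : Measurable gstar) {B q : ℝ} (hB : 0 < B)
    (hg : ∀ x, |gstar x| ≤ B) {X : Fin n → Ω → Tensor d₁ d₂} {ε : Fin n → Ω → ℝ}
    (hX : ∀ i, Measurable (X i)) (hε : ∀ i, Measurable (ε i)) (hP : ∀ i, μ.map (X i) = P)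
    (hind : iIndepFun (fun i ω => (X i ω, ε i ω)) μ)
    (hi2 : ∀ i, Integrable (fun ω => ε i ω ^ 2) μ) (hi : ∀ i, Integrable (ε i) μ)
    (horth : ∀ i, ∀ φ : Tensor d₁ d₂ → ℝ, Measurable φ → ∀ c, (∀ x, |φ x| ≤ c) →
      ∫ ω, φ (X i ω) * ε i ω ∂μ = 0)
    (hq0 : 0 ≤ q) (hq : ∀ i, ∫ ω, tailSq B (ε i ω) ∂μ ≤ q) (θ : TreeCode n d₁ d₂ (n + 1) K) :
    Integrable (fun ω => Real.exp (codeGap P gstar B (fun i => X i ω) (fun i => ε i ω) θ)) μ ∧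
      ∫ ω, Real.exp (codeGap P gstar B (fun i => X i ω) (fun i => ε i ω) θ) ∂μ ≤
        Real.exp (2 ^ K + 6 * n * (1 / (50 * B ^ 2)) * q) := by
  have hm := measurable_codeGap P hgm B θ hX hε
  have hlin : ∫⁻ ω, ENNReal.ofReal
      (Real.exp (codeGap P gstar B (fun i => X i ω) (fun i => ε i ω) θ)) ∂μ ≤
      ENNReal.ofReal (Real.exp (2 ^ K + 6 * n * (1 / (50 * B ^ 2)) * q)) := by
    refine (lintegral_exp_gap_le hX hε hP hind hi2 hi horth hB hq0 hq θ.support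
      (codeError gstar B θ) (measurable_codeError hgm B θ)
      (fun z x => abs_codeError_le hn hB.le hg θ z x) (fun z z' hz => ?_)).trans ?_
    · ext x
      rw [codeError, codeError, θ.eval_congr _ x hz]
    · have h1 : (θ.support.card : ℝ) ≤ 2 ^ K := by
        exact_mod_cast (Nat.le_succ _).trans θ.card_support_le
      gcongr
  have hint : Integrable
      (fun ω => Real.exp (codeGap P gstar B (fun i => X i ω) (fun i => ε i ω) θ)) μ := by
    refine ⟨(Real.measurable_exp.comp hm).aestronglyMeasurable, ?_⟩
    rw [hasFiniteIntegral_iff_ofReal (Filter.Eventually.of_forall fun ω => (Real.exp_pos _).le)]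
    exact hlin.trans_lt ENNReal.ofReal_lt_top
  refine ⟨hint, ?_⟩
  rw [← ofReal_integral_eq_lintegral_ofReal hint
    (Filter.Eventually.of_forall fun ω => (Real.exp_pos _).le)] at hlin
  exact (ENNReal.ofReal_le_ofReal_iff (Real.exp_pos _).le).1 hlin

theorem integral_excess_loss {P : Measure (Tensor d₁ d₂)} {X : Ω → Tensor d₁ d₂} {ε : Ω → ℝ}
    {gstar g : Tensor d₁ d₂ → ℝ} (hgm : Measurable gstar) (hm : Measurable g) {c : ℝ}
    (hb : ∀ x, |gstar x - g x| ≤ c) (hX : Measurable X) (hP : μ.map X = P) (hi : Integrable ε μ)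
    (horth : ∀ φ : Tensor d₁ d₂ → ℝ, Measurable φ → ∀ c, (∀ x, |φ x| ≤ c) →
      ∫ ω, φ (X ω) * ε ω ∂μ = 0) :
    Integrable (fun ω => (gstar (X ω) + ε ω - g (X ω)) ^ 2 - ε ω ^ 2) μ ∧
      ∫ ω, ((gstar (X ω) + ε ω - g (X ω)) ^ 2 - ε ω ^ 2) ∂μ =
        ∫ x, (gstar x - g x) ^ 2 ∂P := by
  have hφ : Measurable fun x => gstar x - g x := hgm.sub hm
  have h1 : Integrable (fun ω => (gstar (X ω) - g (X ω)) ^ 2) μ :=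
    Integrable.of_bound ((hφ.comp hX).pow_const 2).aestronglyMeasurable (c ^ 2)
      (Filter.Eventually.of_forall fun ω => by
        rw [Real.norm_of_nonneg (sq_nonneg _), ← sq_abs]
        exact pow_le_pow_left₀ (abs_nonneg _) (hb _) 2)
  have h2 : Integrable (fun ω => (gstar (X ω) - g (X ω)) * ε ω) μ :=
    hi.bdd_mul (hφ.comp hX).aestronglyMeasurable (Filter.Eventually.of_forall fun ω => hb (X ω))
  have e : (fun ω => (gstar (X ω) + ε ω - g (X ω)) ^ 2 - ε ω ^ 2) =
      fun ω => (gstar (X ω) - g (X ω)) ^ 2 + 2 * ((gstar (X ω) - g (X ω)) * ε ω) := by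
    ext ω; ring
  rw [e]
  refine ⟨h1.add (h2.const_mul 2), ?_⟩
  rw [integral_add h1 (h2.const_mul 2), integral_const_mul, horth _ hφ c hb, mul_zero, add_zero,
    ← hP, integral_map hX.aemeasurable (hφ.pow_const 2).aestronglyMeasurable]

theorem sqL2Dist_eq_ofReal {P : Measure (Tensor d₁ d₂)} [IsProbabilityMeasure P]
    {f g : Tensor d₁ d₂ → ℝ} (hf : Measurable f) (hg : Measurable g) {c : ℝ}
    (hb : ∀ x, |f x - g x| ≤ c) :
    sqL2Dist P f g = ENNReal.ofReal (∫ x, (f x - g x) ^ 2 ∂P) := by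
  rw [sqL2Dist, ofReal_integral_eq_lintegral_ofReal]
  · exact Integrable.of_bound ((hf.sub hg).pow_const 2).aestronglyMeasurable (c ^ 2)
      (Filter.Eventually.of_forall fun x => by
        rw [Real.norm_of_nonneg (sq_nonneg _), ← sq_abs]
        exact pow_le_pow_left₀ (abs_nonneg _) (hb x) 2)
  · exact Filter.Eventually.of_forall fun x => sq_nonneg _

/-- Oracle inequality for one additive representation, with an explicit remainder. -/
theorem lintegral_sqL2Dist_le (hn : 0 < n) (h₁ : 0 < d₁) (h₂ : 0 < d₂) (hK : 1 ≤ K)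
    {P : Measure (Tensor d₁ d₂)} [IsProbabilityMeasure P]
    {gstar : Tensor d₁ d₂ → ℝ} (hgm : Measurable gstar) {B q : ℝ} (hB : 0 < B)
    (hg : ∀ x, |gstar x| ≤ B) {X : Fin n → Ω → Tensor d₁ d₂} {ε : Fin n → Ω → ℝ}
    (hX : ∀ i, Measurable (X i)) (hε : ∀ i, Measurable (ε i)) (hP : ∀ i, μ.map (X i) = P)
    (hind : iIndepFun (fun i ω => (X i ω, ε i ω)) μ)
    (hi2 : ∀ i, Integrable (fun ω => ε i ω ^ 2) μ) (hi : ∀ i, Integrable (ε i) μ)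
    (horth : ∀ i, ∀ φ : Tensor d₁ d₂ → ℝ, Measurable φ → ∀ c, (∀ x, |φ x| ≤ c) →
      ∫ ω, φ (X i ω) * ε i ω ∂μ = 0)
    (hq0 : 0 ≤ q) (hq : ∀ i, ∫ ω, tailSq B (ε i ω) ∂μ ≤ q)
    {T : Ω → TensorTree d₁ d₂}
    (hT : ∀ᵐ ω ∂μ, IsSSETree (fun i => X i ω) (fun i => gstar (X i ω) + ε i ω) K
      Finset.univ (T ω))
    {g : Tensor d₁ d₂ → ℝ} {h : Fin d₁ → Fin d₂ → ℝ → ℝ} (hgh : IsAdditiveRep g h)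
    (hh : ∀ i₁ i₂, eVariationOn (h i₁ i₂) Set.univ ≠ ⊤)
    {V : ℝ} (hV : V = ∑ i₂, ∑ i₁, (eVariationOn (h i₁ i₂) Set.univ).toReal) :
    ∫⁻ ω, sqL2Dist P gstar (T ω).eval ∂μ ≤ ENNReal.ofReal
      (2 * ∫ x, (gstar x - g x) ^ 2 ∂P + 2 * (V ^ 2 / (K + 3)) +
        (100 * B ^ 2 / n * (Real.log (Fintype.card (TreeCode n d₁ d₂ (n + 1) K)) + 2 ^ K) +
          88 * B ^ 2 / n + 23 * n * q)) := by
  have hn' : (0 : ℝ) < n := by exact_mod_cast hn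
  have hgm' := hgh.measurable hh
  obtain ⟨c, hc⟩ := hgh.exists_abs_le hh
  have hc' : ∀ x, |gstar x - g x| ≤ B + c := fun x =>
    (abs_sub _ _).trans (add_le_add (hg x) (hc x))
  set N : ℝ := ((Fintype.card (TreeCode n d₁ d₂ (n + 1) K) : ℕ) : ℝ) with hN
  have hN1 : 1 ≤ N := by
    have : Nonempty (TreeCode n d₁ d₂ (n + 1) K) :=
      ⟨(TreeCode.exists_eval_eq_const (fun _ => 0) 0 ⟨0, hn⟩ ⟨0, h₁⟩ ⟨0, h₂⟩ (fun _ => 0) K).choose⟩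
    have hpos : 0 < Fintype.card (TreeCode n d₁ d₂ (n + 1) K) := Fintype.card_pos
    rw [hN]
    exact_mod_cast hpos
  have hN0 : 0 < N := by linarith
  set a : ℝ := 2 ^ K + 6 * n * (1 / (50 * B ^ 2)) * q with ha
  have ha1 : 1 ≤ a := by
    have h3 : (1 : ℝ) ≤ 2 ^ K := one_le_pow₀ (by norm_num)
    have h4 : 0 ≤ 6 * n * (1 / (50 * B ^ 2)) * q := by positivity
    linarith
  -- `A` bounds the expected sum of exponentials, so in expectation `F / A` is at most 1 and cancels
  -- the `-1` of the tangent bound.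
  set A : ℝ := N * Real.exp a with hA
  have hA0 : 0 < A := by positivity
  have hAe : Real.exp 1 ≤ A := by
    calc Real.exp 1 ≤ 1 * Real.exp a := by rw [one_mul]; exact Real.exp_le_exp.2 ha1
      _ ≤ A := by rw [hA]; gcongr
  have hlogA : Real.log A = Real.log N + a := by
    rw [hA, Real.log_mul hN0.ne' (Real.exp_pos _).ne', Real.log_exp]
  have hgap := fun θ : TreeCode n d₁ d₂ (n + 1) K => integrable_exp_codeGap hn hgm hB hg hX hε hP
    hind hi2 hi horth hq0 hq θ
  have hexc := fun i => integral_excess_loss hgm hgm' hc' (hX i) (hP i) (hi i) (horth i)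
  set F : Ω → ℝ := fun ω => ∑ θ : TreeCode n d₁ d₂ (n + 1) K,
    Real.exp (codeGap P gstar B (fun i => X i ω) (fun i => ε i ω) θ) with hF
  have hFi : Integrable F μ := integrable_finsetSum _ fun θ _ => (hgap θ).1
  have hFA : ∫ ω, F ω ∂μ ≤ A := by
    rw [hF, integral_finsetSum _ fun θ _ => (hgap θ).1]
    refine (Finset.sum_le_sum fun θ _ => (hgap θ).2).trans_eq ?_
    rw [Finset.sum_const, Finset.card_univ, nsmul_eq_mul]
  set G : Ω → ℝ := fun ω => ∑ i, ((gstar (X i ω) + ε i ω - g (X i ω)) ^ 2 - ε i ω ^ 2) with hG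
  have hGi : Integrable G μ := integrable_finsetSum _ fun i _ => (hexc i).1
  have hGv : ∫ ω, G ω ∂μ = n * ∫ x, (gstar x - g x) ^ 2 ∂P := by
    rw [hG, integral_finsetSum _ fun i _ => (hexc i).1, Finset.sum_congr rfl fun i _ => (hexc i).2,
      Finset.sum_const, Finset.card_univ, Fintype.card_fin, nsmul_eq_mul]
  set H : Ω → ℝ := fun ω => ∑ i, tailSq B (ε i ω) with hH
  have hHi : Integrable H μ :=
    integrable_finsetSum _ fun i _ => integrable_tailSq (hε i) (hi2 i)
  have hHv : ∫ ω, H ω ∂μ ≤ n * q := by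
    rw [hH, integral_finsetSum _ fun i _ => integrable_tailSq (hε i) (hi2 i)]
    refine (Finset.sum_le_sum fun i _ => hq i).trans_eq ?_
    rw [Finset.sum_const, Finset.card_univ, Fintype.card_fin, nsmul_eq_mul]
  set κ : ℝ := 2 * (V ^ 2 / (K + 3)) + 100 * B ^ 2 / n * (Real.log A - 1) + 88 * B ^ 2 / n with hκ
  -- An integrable majorant that does not involve `T`; thus the choice among tied splits plays no
  -- role in the expectation.
  set W : Ω → ℝ := fun ω => 2 / n * G ω + 100 * B ^ 2 / n / A * F ω + 11 * H ω + κ with hW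
  have hWi : Integrable W μ :=
    (((hGi.const_mul _).add (hFi.const_mul _)).add (hHi.const_mul _)).add (integrable_const _)
  have hWv : ∫ ω, W ω ∂μ ≤ 2 * ∫ x, (gstar x - g x) ^ 2 ∂P + 2 * (V ^ 2 / (K + 3)) +
        (100 * B ^ 2 / n * (Real.log N + 2 ^ K) + 88 * B ^ 2 / n + 23 * n * q) := by
    have i1 : Integrable (fun ω => 2 / n * G ω) μ := hGi.const_mul _
    have i2 : Integrable (fun ω => 2 / n * G ω + 100 * B ^ 2 / n / A * F ω) μ :=
      i1.add (hFi.const_mul _)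
    have i3 : Integrable (fun ω => 2 / n * G ω + 100 * B ^ 2 / n / A * F ω + 11 * H ω) μ :=
      i2.add (hHi.const_mul _)
    have e : ∫ ω, W ω ∂μ = 2 / n * ∫ ω, G ω ∂μ + 100 * B ^ 2 / n / A * ∫ ω, F ω ∂μ +
        11 * ∫ ω, H ω ∂μ + κ := by
      rw [hW, integral_add i3 (integrable_const _), integral_add i2 (hHi.const_mul _),
        integral_add i1 (hFi.const_mul _), integral_const_mul, integral_const_mul,
        integral_const_mul]
      simp
    have t1 : 2 / n * ∫ ω, G ω ∂μ = 2 * ∫ x, (gstar x - g x) ^ 2 ∂P := by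
      rw [hGv]; field_simp
    have t2 : 100 * B ^ 2 / n / A * ∫ ω, F ω ∂μ ≤ 100 * B ^ 2 / n := by
      calc _ ≤ 100 * B ^ 2 / n / A * A := by gcongr
        _ = _ := by field_simp
    have t3 : 100 * B ^ 2 / n * (Real.log A - 1) =
        100 * B ^ 2 / n * (Real.log N + 2 ^ K) + 12 * q - 100 * B ^ 2 / n := by
      rw [hlogA, ha]; field_simp; ring
    have t4 : 12 * q ≤ 12 * (n * q) := by
      have : (1 : ℝ) ≤ n := by exact_mod_cast hn
      nlinarith
    rw [e, t1, hκ, t3]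
    linarith
  have hpt : ∀ᵐ ω ∂μ, sqL2Dist P gstar (T ω).eval ≤ ENNReal.ofReal (W ω) ∧ 0 ≤ W ω := by
    filter_upwards [hT] with ω hω
    have hD := hω.integral_sq_le hn h₁ h₂ P hgm hB hg (fun i => X i ω) (fun i => ε i ω) hAe
    have htr := IsSSETree.training_error_le _ _ hgh hh hV hK _ _ hω
    rw [Finset.card_univ, Fintype.card_fin] at htr
    have hDW : ∫ x, (gstar x - (T ω).eval x) ^ 2 ∂P ≤ W ω := by
      refine hD.trans ?_
      have h5 : 2 / n * ∑ i, ((gstar (X i ω) + ε i ω - (T ω).eval (X i ω)) ^ 2 - ε i ω ^ 2) ≤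
          2 / n * (G ω + n * (V ^ 2 / (K + 3))) := by
        have h2n : 0 ≤ 2 / (n : ℝ) := by positivity
        refine mul_le_mul_of_nonneg_left ?_ h2n
        simp only [hG]
        rw [Finset.sum_sub_distrib, Finset.sum_sub_distrib]
        linarith
      have h6 : 2 / n * (G ω + n * (V ^ 2 / (K + 3))) =
          2 / n * G ω + 2 * (V ^ 2 / (K + 3)) := by field_simp
      have h7 : 100 * B ^ 2 / n * (Real.log A + F ω / A - 1) =
          100 * B ^ 2 / n * (Real.log A - 1) + 100 * B ^ 2 / n / A * F ω := by ring
      change _ + 100 * B ^ 2 / n * (Real.log A + F ω / A - 1) + _ + 11 * H ω ≤ _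
      rw [h7]
      simp only [hW, hκ]
      linarith
    have hW0 : 0 ≤ W ω := (integral_nonneg fun x => sq_nonneg _).trans hDW
    refine ⟨?_, hW0⟩
    -- A bound depending on `ω` suffices: it serves only to identify `sqL2Dist` with a Bochner
    -- integral.
    obtain ⟨R, hR⟩ : ∃ R, ∀ i, |gstar (X i ω) + ε i ω| ≤ R :=
      ⟨∑ i, |gstar (X i ω) + ε i ω|, fun i =>
        Finset.single_le_sum (f := fun i => |gstar (X i ω) + ε i ω|) (fun _ _ => abs_nonneg _)
          (Finset.mem_univ i)⟩
    have hR0 : 0 ≤ R := (abs_nonneg _).trans (hR ⟨0, hn⟩)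
    rw [sqL2Dist_eq_ofReal hgm (T ω).measurable_eval (c := B + R) fun x =>
      (abs_sub _ _).trans (add_le_add (hg x) (hω.abs_eval_le hR0 hR x K _ _))]
    exact ENNReal.ofReal_le_ofReal hDW
  calc ∫⁻ ω, sqL2Dist P gstar (T ω).eval ∂μ ≤ ∫⁻ ω, ENNReal.ofReal (W ω) ∂μ :=
        lintegral_mono_ae (hpt.mono fun _ h => h.1)
    _ = ENNReal.ofReal (∫ ω, W ω ∂μ) :=
        (ofReal_integral_eq_lintegral_ofReal hWi (hpt.mono fun _ h => h.2)).symm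
    _ ≤ _ := ENNReal.ofReal_le_ofReal hWv

end Oracle

/-! ### Constants, infimum over representations, and conclusion -/

/-- The logarithm of the number of codes is at most `3 · 2 ^ K log (n d₁ d₂)`, using `n + 1 ≤ n²`.
All other terms are absorbed because `log (n d₁ d₂) ≥ log 2 > 0.69`. -/
theorem remainder_le {n d₁ d₂ K : ℕ} (hn : 2 ≤ n) (h₁ : 1 ≤ d₁) (h₂ : 1 ≤ d₂) {b σsq : ℝ}
    (hb : 32 * σsq ≤ b ^ 2 * Real.log 2) (hσ : 0 < σsq) :
    100 * (b * Real.log n) ^ 2 / n *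
        (Real.log (Fintype.card (TreeCode n d₁ d₂ (n + 1) K)) + 2 ^ K) +
      88 * (b * Real.log n) ^ 2 / n + 23 * n * (24 * σsq / n ^ 4) ≤
    2 * (500 * b ^ 2 * (2 ^ K * Real.log n ^ 2 * Real.log (n * d₁ * d₂) / n)) := by
  have hn2 : (2 : ℝ) ≤ n := by exact_mod_cast hn
  have hn0 : (0 : ℝ) < n := by linarith
  have hd₁ : (1 : ℝ) ≤ d₁ := by exact_mod_cast h₁
  have hd₂ : (1 : ℝ) ≤ d₂ := by exact_mod_cast h₂
  set ℓ := Real.log n with hℓ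
  set Λ := Real.log (n * d₁ * d₂) with hΛ
  have hl2 : (0.69 : ℝ) < Real.log 2 := by have := Real.log_two_gt_d9; linarith
  have hℓ2 : Real.log 2 ≤ ℓ := Real.log_le_log two_pos hn2
  have hℓΛ : ℓ ≤ Λ := by
    refine Real.log_le_log hn0 ?_
    calc (n : ℝ) = n * 1 * 1 := by ring
      _ ≤ n * d₁ * d₂ := by gcongr
  have hΛ0 : 0.69 < Λ := by linarith
  have h2K : (1 : ℝ) ≤ 2 ^ K := one_le_pow₀ (by norm_num)
  have hnd : (0 : ℝ) < n * d₁ * d₂ := by positivity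
  have hcard : Real.log (Fintype.card (TreeCode n d₁ d₂ (n + 1) K)) ≤ 2 ^ K * (3 * Λ) := by
    have hc := TreeCode.card_le (m := n + 1) (by omega : 0 < n) (by omega : 0 < d₁)
      (by omega : 0 < d₂) K
    have hc' : (Fintype.card (TreeCode n d₁ d₂ (n + 1) K) : ℝ) ≤
        ((n * d₁ * d₂) * (n + 1)) ^ 2 ^ K := by exact_mod_cast hc
    rcases Nat.eq_zero_or_pos (Fintype.card (TreeCode n d₁ d₂ (n + 1) K)) with h0 | h0
    · rw [h0]; simp only [Nat.cast_zero, Real.log_zero]; positivity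
    · refine (Real.log_le_log (by exact_mod_cast h0) hc').trans ?_
      rw [Real.log_pow, Real.log_mul hnd.ne' (by positivity)]
      have : Real.log (n + 1) ≤ 2 * ℓ := by
        have e : 2 * ℓ = Real.log ((n : ℝ) ^ 2) := by rw [hℓ, Real.log_pow]; norm_num
        rw [e]
        exact Real.log_le_log (by positivity) (by nlinarith)
      push_cast
      gcongr
      linarith
  have hσ' : 23 * n * (24 * σsq / (n : ℝ) ^ 4) ≤ 36 * b ^ 2 * ℓ ^ 2 / n := by
    have e : 23 * n * (24 * σsq / (n : ℝ) ^ 4) = 552 * σsq / n ^ 2 / n := by field_simp; norm_num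
    rw [e]
    gcongr
    have s1 : 552 * σsq / (n : ℝ) ^ 2 ≤ 552 * σsq := div_le_self (by positivity) (by nlinarith)
    have s2 : b ^ 2 * Real.log 2 ≤ b ^ 2 * (2 * ℓ ^ 2) := by
      gcongr
      nlinarith
    nlinarith
  have hmain : (100 * (Real.log (Fintype.card (TreeCode n d₁ d₂ (n + 1) K)) + 2 ^ K) + 124) ≤
      1000 * (2 ^ K * Λ) := by
    have s1 : (2 : ℝ) ^ K * 0.69 ≤ 2 ^ K * Λ := by gcongr
    nlinarith
  have hc0 : 0 ≤ b ^ 2 * ℓ ^ 2 / n := by positivity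
  have := mul_le_mul_of_nonneg_left hmain hc0
  have e1 : 100 * (b * ℓ) ^ 2 / n *
        (Real.log (Fintype.card (TreeCode n d₁ d₂ (n + 1) K)) + 2 ^ K) +
      88 * (b * ℓ) ^ 2 / n + 36 * b ^ 2 * ℓ ^ 2 / n = b ^ 2 * ℓ ^ 2 / n *
      (100 * (Real.log (Fintype.card (TreeCode n d₁ d₂ (n + 1) K)) + 2 ^ K) + 124) := by ring
  have e2 : b ^ 2 * ℓ ^ 2 / n * (1000 * (2 ^ K * Λ)) =
      2 * (500 * b ^ 2 * (2 ^ K * ℓ ^ 2 * Λ / n)) := by ring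
  linarith

/-- The infimum over representations in `tvNorm` may be taken outside of the oracle bound. -/
theorem le_oracle_bound_of_forall_rep {d₁ d₂ : ℕ} {g : Tensor d₁ d₂ → ℝ}
    {a r k I : ℝ≥0∞} (hk : k ≠ 0) (hkt : k ≠ ⊤)
    (hI : ∀ h : Fin d₁ → Fin d₂ → ℝ → ℝ, IsAdditiveRep g h →
      (∀ i₁ i₂, eVariationOn (h i₁ i₂) Set.univ ≠ ⊤) →
      I ≤ 2 * (a + (∑ i₂, ∑ i₁, eVariationOn (h i₁ i₂) Set.univ) ^ 2 / k + r)) :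
    I ≤ 2 * (a + tvNorm g ^ 2 / k + r) := by
  set f : ℝ≥0∞ → ℝ≥0∞ := fun v => 2 * (a + v ^ 2 / k + r) with hf
  have hfc : Continuous f := by
    refine (ENNReal.continuous_const_mul (by norm_num)).comp ?_
    refine Continuous.add (Continuous.add continuous_const ?_) continuous_const
    exact (ENNReal.continuous_div_const k hk).comp (ENNReal.continuous_pow 2)
  have hfm : Monotone f := fun u v huv => by simp only [hf]; gcongr
  -- Needed to commute `f` with an infimum over a possibly empty family, and to discard
  -- representations of infinite variation.
  have hft : f ⊤ = ⊤ := by simp [hf, ENNReal.top_div_of_ne_top hkt]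
  change I ≤ f (tvNorm g)
  rw [tvNorm, iInf_subtype', hfm.map_iInf_of_continuousAt hfc.continuousAt hft]
  refine le_iInf fun ⟨h, hh⟩ => ?_
  by_cases hv : ∀ i₁ i₂, eVariationOn (h i₁ i₂) Set.univ ≠ ⊤
  · exact hI h hh hv
  · push Not at hv
    obtain ⟨i₁, i₂, hv⟩ := hv
    have htop : ∑ i₂, ∑ i₁, eVariationOn (h i₁ i₂) Set.univ = ⊤ :=
      ENNReal.sum_eq_top.2 ⟨i₂, Finset.mem_univ _, ENNReal.sum_eq_top.2 ⟨i₁, Finset.mem_univ _, hv⟩⟩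
    change I ≤ f (∑ i₂, ∑ i₁, eVariationOn (h i₁ i₂) Set.univ)
    rw [htop, hft]
    exact le_top

theorem mainTheorem2 (M σsq : ℝ) (hσ : 0 < σsq) :
    ∃ C₁ : ℝ, 0 < C₁ ∧
      ∀ (n d₁ d₂ K : ℕ), 2 ≤ n → 1 ≤ d₁ → 1 ≤ d₂ → 1 ≤ K →
      ∀ {Ω : Type*} [MeasurableSpace Ω] (μ : Measure Ω) [IsProbabilityMeasure μ]
        (P : Measure (Tensor d₁ d₂)) (gstar : Tensor d₁ d₂ → ℝ)
        (X : Fin n → Ω → Tensor d₁ d₂) (ε : Fin n → Ω → ℝ) (T : Ω → TensorTree d₁ d₂),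
        Measurable gstar →
        (∀ᵐ x ∂P, |gstar x| ≤ M) →
        (∀ i, Measurable (X i)) →
        (∀ i, Measurable (ε i)) →
        (∀ i, μ.map (X i) = P) →
        iIndepFun (fun i ω => (X i ω, ε i ω)) μ →
        (∀ i, μ[ε i | MeasurableSpace.comap (X i) inferInstance] =ᵐ[μ] 0) →
        (∀ i, ∀ u : ℝ, 0 ≤ u →
          μ.real {ω | u ≤ |ε i ω|} ≤ 2 * Real.exp (-u ^ 2 / (2 * σsq))) →
        (∀ ω, IsSSETree (fun i => X i ω) (fun i => gstar (X i ω) + ε i ω) K Finset.univ (T ω)) →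
        ∫⁻ ω, sqL2Dist P gstar (T ω).eval ∂μ ≤
          2 * ⨅ g ∈ additiveClass d₁ d₂,
            (sqL2Dist P gstar g + tvNorm g ^ 2 / ((K : ℝ≥0∞) + 3) +
              ENNReal.ofReal (C₁ * (2 ^ K * Real.log n ^ 2 * Real.log (n * d₁ * d₂) / n))) := by
  have hl2 : 0 < Real.log 2 := Real.log_pos (by norm_num)
  -- Since `log n ≥ log 2`, these conditions make `B = b log n` at least `|M|` and `B² / (8 σsq)` at
  -- least `4 log n`, for every `n ≥ 2`.
  obtain ⟨b, hb0, hbM, hbσ⟩ : ∃ b : ℝ, 0 < b ∧ |M| ≤ b * Real.log 2 ∧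
      32 * σsq ≤ b ^ 2 * Real.log 2 := by
    refine ⟨√(32 * σsq / Real.log 2) + |M| / Real.log 2, by positivity, ?_, ?_⟩
    · rw [add_mul, div_mul_cancel₀ _ hl2.ne']
      exact le_add_of_nonneg_left (by positivity)
    · have h1 : √(32 * σsq / Real.log 2) ^ 2 ≤
          (√(32 * σsq / Real.log 2) + |M| / Real.log 2) ^ 2 :=
        pow_le_pow_left₀ (by positivity) (le_add_of_nonneg_right (by positivity)) 2
      rw [Real.sq_sqrt (by positivity)] at h1
      calc 32 * σsq = 32 * σsq / Real.log 2 * Real.log 2 := by field_simp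
        _ ≤ _ := by gcongr
  refine ⟨500 * b ^ 2, by positivity, ?_⟩
  intro n d₁ d₂ K hn h₁ h₂ hK Ω _ μ _ P gstar X ε T hgm hgM hX hε hP hind hcond htail hT
  have hn0 : 0 < n := by omega
  have hn2 : (2 : ℝ) ≤ n := by exact_mod_cast hn
  have hnpos : (0 : ℝ) < n := by linarith
  have hPp : IsProbabilityMeasure P := hP ⟨0, hn0⟩ ▸
    Measure.isProbabilityMeasure_map (hX ⟨0, hn0⟩).aemeasurable
  set ℓ := Real.log n with hℓ
  have hℓ2 : Real.log 2 ≤ ℓ := Real.log_le_log two_pos hn2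
  have hℓ0 : 0 < ℓ := hl2.trans_le hℓ2
  set B := b * ℓ with hBdef
  have hB : 0 < B := by positivity
  have hMB : |M| ≤ B := hbM.trans (by rw [hBdef]; gcongr)
  -- Clipping gives a version of `gstar` bounded everywhere. It agrees with `gstar` almost surely at
  -- all sample points, so `T` is still a greedy tree for the modified responses.
  set gt : Tensor d₁ d₂ → ℝ := fun x => max (-B) (min B (gstar x)) with hgt
  have hgtm : Measurable gt := measurable_const.max (measurable_const.min hgm)
  have hgtb : ∀ x, |gt x| ≤ B := fun x => abs_le.2
    ⟨le_max_left _ _, max_le (by linarith) (min_le_left _ _)⟩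
  have hgte : ∀ᵐ x ∂P, gstar x = gt x := by
    filter_upwards [hgM] with x hx
    have h3 := abs_le.1 ((hx.trans (le_abs_self M)).trans hMB)
    rw [hgt]
    simp only
    rw [min_eq_right h3.2, max_eq_right h3.1]
  have hdist : ∀ f, sqL2Dist P gstar f = sqL2Dist P gt f := fun f =>
    lintegral_congr_ae (hgte.mono fun x hx => by simp only [hx])
  have hTt : ∀ᵐ ω ∂μ, IsSSETree (fun i => X i ω) (fun i => gt (X i ω) + ε i ω) K
      Finset.univ (T ω) := by
    have : ∀ᵐ ω ∂μ, ∀ i, gstar (X i ω) = gt (X i ω) := ae_all_iff.2 fun i =>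
      ae_of_ae_map (hX i).aemeasurable ((hP i).symm ▸ hgte)
    filter_upwards [this] with ω hω
    have := hT ω
    simp only [hω] at this
    exact this
  have hi := fun i => integrable_of_tail hσ (hε i) (htail i)
  have hi2 := fun i => integrable_sq_of_tail hσ (hε i) (htail i)
  have horth := fun i (φ : Tensor d₁ d₂ → ℝ) (hφ : Measurable φ) (c : ℝ) (hc : ∀ x, |φ x| ≤ c) =>
    integral_mul_comp_eq_zero_of_condExp (hX i) (hi i) (hcond i) hφ hc
  have hq : ∀ i, ∫ ω, tailSq B (ε i ω) ∂μ ≤ 24 * σsq / n ^ 4 := by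
    intro i
    refine (integral_tailSq_le_of_tail hσ (hε i) (htail i) hB.le).trans ?_
    rw [div_eq_mul_inv (24 * σsq)]
    have e : ((n : ℝ) ^ 4)⁻¹ = Real.exp (-(4 * ℓ)) := by
      rw [Real.exp_neg, hℓ, show (4 : ℝ) * Real.log n = Real.log ((n : ℝ) ^ 4) by
        rw [Real.log_pow]; norm_num, Real.exp_log (by positivity)]
    rw [e]
    gcongr
    rw [neg_div, neg_le_neg_iff, le_div_iff₀ (by positivity), hBdef]
    have h4 : b ^ 2 * Real.log 2 * ℓ ≤ b ^ 2 * ℓ * ℓ := by gcongr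
    have h5 : 32 * σsq * ℓ ≤ b ^ 2 * Real.log 2 * ℓ := by gcongr
    linarith
  rw [ENNReal.mul_iInf_of_ne (by norm_num) (by norm_num)]
  refine le_iInf fun g => ?_
  rw [ENNReal.mul_iInf_of_ne (by norm_num) (by norm_num)]
  refine le_iInf fun _ => ?_
  have hk : (K : ℝ≥0∞) + 3 = ENNReal.ofReal ((K : ℝ) + 3) := by
    rw [ENNReal.ofReal_add (by positivity) (by norm_num), ENNReal.ofReal_natCast]
    norm_num
  refine le_oracle_bound_of_forall_rep (by simp) (by rw [hk]; exact ENNReal.ofReal_ne_top)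
    fun h hgh hh => ?_
  have hmain := lintegral_sqL2Dist_le hn0 h₁ h₂ hK hgtm hB hgtb hX hε hP hind hi2 hi horth
    (by positivity) hq hTt hgh hh rfl
  simp only [hdist]
  refine hmain.trans ?_
  obtain ⟨c, hc⟩ := hgh.exists_abs_le hh
  rw [sqL2Dist_eq_ofReal hgtm (hgh.measurable hh) (c := B + c) fun x =>
    (abs_sub _ _).trans (add_le_add (hgtb x) (hc x))]
  have hVe : ∑ i₂, ∑ i₁, eVariationOn (h i₁ i₂) Set.univ = ENNReal.ofReal
      (∑ i₂, ∑ i₁, (eVariationOn (h i₁ i₂) Set.univ).toReal) := by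
    rw [ENNReal.ofReal_sum_of_nonneg fun _ _ => Finset.sum_nonneg fun _ _ => ENNReal.toReal_nonneg]
    refine Finset.sum_congr rfl fun i₂ _ => ?_
    rw [ENNReal.ofReal_sum_of_nonneg fun _ _ => ENNReal.toReal_nonneg]
    exact Finset.sum_congr rfl fun i₁ _ => (ENNReal.ofReal_toReal (hh i₁ i₂)).symm
  have hV0 : 0 ≤ ∑ i₂, ∑ i₁, (eVariationOn (h i₁ i₂) Set.univ).toReal :=
    Finset.sum_nonneg fun _ _ => Finset.sum_nonneg fun _ _ => ENNReal.toReal_nonneg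
  have hD0 : 0 ≤ ∫ x, (gt x - g x) ^ 2 ∂P := integral_nonneg fun x => sq_nonneg _
  have hrem := remainder_le (K := K) hn h₁ h₂ hbσ hσ
  have hΛ : 0 ≤ Real.log (n * d₁ * d₂) := by
    have h6 : ((1 : ℕ) : ℝ) ≤ (n * d₁ * d₂ : ℕ) := by
      exact_mod_cast Nat.succ_le_of_lt (by positivity)
    exact Real.log_nonneg (by push_cast at h6; exact h6)
  rw [hVe, hk, ← ENNReal.ofReal_pow hV0, ← ENNReal.ofReal_div_of_pos (by positivity),
    ← ENNReal.ofReal_add hD0 (by positivity), ← ENNReal.ofReal_add (by positivity) (by positivity),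
    show (2 : ℝ≥0∞) = ENNReal.ofReal 2 by norm_num, ← ENNReal.ofReal_mul (by norm_num)]
  refine ENNReal.ofReal_le_ofReal ?_
  linarith
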